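/- Let $K$ be a non-archimedean local field with ring of integers $\mathfrak D$, let $dx$ be the Haar measure of $(K,+)$ with $|\mathfrak D|=1$, and let $|\cdot|$ be the normalized absolute value, $d(\alpha x)=|\alpha|\,dx$. Let $\chi$ be a continuous unitary character of $(K,+)$ with conductor $\mathfrak D$ (that is, $\chi(x\mathfrak D)=\{1\}$ if and only if $x\in\mathfrak D$), and $\widehat g(\xi)=\int_K g(v)\,\chi(-v\xi)\,dv$. Let $G=K\rtimes K^*$ with $(x,h)(y,k)=(hy+x,hk)$, the product topology, and left Haar measure $\mu_G$ given by $\int_G F\,d\mu_G=\int_{K^*}\int_K F(x,h)\,dx\,\frac{d^*h}{|h|}$, where $d^*h=dh/|h|$ is the Haar measure of $K^*$ obtained by restricting $dx$. Let $(\pi(x,h)f)(y)=|h|^{-1/2}f(h^{-1}(y-x))$ be the quasi-regular representation of $G$ on $L^2(K)$, and $\langle\cdot|\cdot\rangle$ the inner product of $L^2(K)$, linear in the first argument. Let $\mathcal S_0(K)$ be the space of locally constant, compactly supported functions $g:K\to\mathbb C$ with $\int_K g\,dx=0$. **Theorem.** Let $0\neq g\in\mathcal S_0(K)$, let $H<G$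 be a compact open subgroup with $\pi(x,h)g=g$ for all $(x,h)\in H$, and let $R\subset G$ be any system of representatives of the left cosets of $H$, so that $G=\bigsqcup_{r\in R}rH$. Put $$C_g=\int_K\frac{|\widehat g(\xi)|^2}{|\xi|}\,d\xi .$$ Then this integral is finite, and $C_g$ is the constant of the wavelet transform: $\int_G|\langle f|\pi(r)g\rangle|^2\,d\mu_G(r)=C_g\|f\|_2^2$ for all $f\in L^2(K)$. Moreover $(\pi(r)g)_{r\in R}$ is a tight frame of $L^2(K)$ with frame constant $C_g/\mu_G(H)>0$: for all $f\in L^2(K)$, $$\sum_{r\in R}|\langle f|\pi(r)g\rangle|^2=\frac{C_g}{\mu_G(H)}\,\|f\|_2^2 ,$$ and the wavelet expansion $$f=\frac{\mu_G(H)}{C_g}\sum_{r\in R}\langle f|\pi(r)g\rangle\,\pi(r)g$$ holds with unconditional convergence in $L^2(K)$. -/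

import Mathlib

open MeasureTheory ValuativeRel
open scoped ENNReal NNReal

/-! ### Absolute value and Haar measure of a non-archimedean local field -/

namespace LocalFieldWavelet

noncomputable section

section Field

variable {K : Type*} [Field K] [ValuativeRel K] [TopologicalSpace K]
  [IsNonarchimedeanLocalField K]

/-- The normalized absolute value: for `x ≠ 0`, `|x|` is the factor by which multiplication by `x`
scales every Haar measure of `(K, +)`, and `|0| = 0`. -/
def absv (x : K) : ℝ≥0 :=
  open scoped Classical in
  if h : x = 0 then 0 else distribHaarChar K (Units.mk0 x h)

theorem absv_units (h : Kˣ) : absv (h : K) = distribHaarChar K h := by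
  simp [absv]

theorem absv_units_pos (h : Kˣ) : 0 < absv (h : K) := by
  rw [absv_units]; exact distribHaarChar_pos

variable (K) in
/-- The ring of integers as a compact set with nonempty interior. -/
def integerCompacts : TopologicalSpace.PositiveCompacts K where
  carrier := {x : K | valuation K x ≤ 1}
  isCompact' := IsNonarchimedeanLocalField.isCompact_closedBall K 1
  interior_nonempty' := by
    refine ⟨0, mem_interior_iff_mem_nhds.mpr ?_⟩
    refine (IsValuativeTopology.mem_nhds_zero_iff _).mpr ⟨1, fun x hx => ?_⟩
    exact le_of_lt (by simpa using hx)

variable [MeasurableSpace K] [BorelSpace K]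

variable (K) in
/-- The Haar measure `dx` of `(K, +)`, normalized so that the ring of integers has measure one. -/
def haarK : Measure K := Measure.addHaarMeasure (integerCompacts K)

instance : (haarK K).IsAddHaarMeasure := by unfold haarK; infer_instance

instance : (haarK K).Regular := by unfold haarK; infer_instance

theorem haarK_integers : haarK K {x : K | valuation K x ≤ 1} = 1 :=
  Measure.addHaarMeasure_self (K₀ := integerCompacts K)

variable (K) in
/-- The Haar measure `dx / |x|` of the multiplicative group `Kˣ`. -/
def haarUnits : Measure Kˣ :=
  ((haarK K).withDensity fun x => ((absv x : ℝ≥0∞))⁻¹).comap ((↑) : Kˣ → K)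

end Field

/-! ### The affine group `K ⋊ Kˣ` -/

/-- The affine group: the underlying set is `K × Kˣ`. -/
def AffineGroup (K : Type*) [Field K] : Type _ := K × Kˣ

namespace AffineGroup

variable {K : Type*} [Field K]

/-- The group law is `(x, h) (y, k) = (h y + x, h k)`. -/
instance : Group (AffineGroup K) where
  mul a b := ((a.2 : K) * b.1 + a.1, a.2 * b.2)
  one := ((0 : K), (1 : Kˣ))
  inv a := (-(((a.2⁻¹ : Kˣ) : K) * a.1), a.2⁻¹)
  mul_assoc a b c := by
    refine Prod.ext ?_ (mul_assoc a.2 b.2 c.2)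
    change ((a.2 * b.2 : Kˣ) : K) * c.1 + ((a.2 : K) * b.1 + a.1)
      = (a.2 : K) * ((b.2 : K) * c.1 + b.1) + a.1
    push_cast; ring
  one_mul a := by
    refine Prod.ext ?_ (one_mul a.2)
    change ((1 : Kˣ) : K) * a.1 + 0 = a.1
    simp
  mul_one a := by
    refine Prod.ext ?_ (mul_one a.2)
    change (a.2 : K) * 0 + a.1 = a.1
    simp
  inv_mul_cancel a := by
    refine Prod.ext ?_ (inv_mul_cancel a.2)
    change ((a.2⁻¹ : Kˣ) : K) * a.1 + -(((a.2⁻¹ : Kˣ) : K) * a.1) = 0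
    simp

/-- The product topology, `Kˣ` carrying the topology of the group of units. -/
instance [TopologicalSpace K] : TopologicalSpace (AffineGroup K) :=
  inferInstanceAs (TopologicalSpace (K × Kˣ))

instance [MeasurableSpace K] : MeasurableSpace (AffineGroup K) :=
  inferInstanceAs (MeasurableSpace (K × Kˣ))

end AffineGroup

section Wavelets

variable {K : Type*} [Field K] [ValuativeRel K] [TopologicalSpace K]
  [IsNonarchimedeanLocalField K] [MeasurableSpace K] [BorelSpace K]

variable (K) in
/-- The left Haar measure of the affine group, `∫ f = ∫_{Kˣ} ∫_K f (x, h) dx dh / |h|`,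
where `dh` is the Haar measure of `Kˣ`. -/
def haarAffine : Measure (AffineGroup K) :=
  ((haarK K).prod (haarUnits K)).withDensity fun r : K × Kˣ => ((absv (r.2 : K) : ℝ≥0∞))⁻¹

theorem smul_map_affine (x : K) (h : Kˣ) :
    (haarK K).map (fun y => ((h⁻¹ : Kˣ) : K) * (y - x)) = absv (h : K) • haarK K := by
  have hmul : Measurable fun y : K => ((h⁻¹ : Kˣ) : K) * y :=
    (continuous_const.mul continuous_id).measurable
  have hsub : Measurable fun y : K => y - x := (continuous_id.sub continuous_const).measurable
  have h1 : (haarK K).map (fun y => y - x) = haarK K := by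
    simpa [sub_eq_add_neg] using map_add_right_eq_self (haarK K) (-x)
  have h2 : (haarK K).map (fun y => ((h⁻¹ : Kˣ) : K) * (y - x))
      = (haarK K).map (fun y => ((h⁻¹ : Kˣ) : K) * y) := by
    conv_rhs => rw [← h1]
    rw [Measure.map_map hmul hsub]
    rfl
  rw [h2]
  ext s hs
  rw [Measure.map_apply hmul hs, Measure.smul_apply, absv_units, ENNReal.smul_def, smul_eq_mul,
    distribHaarChar_mul]
  congr 1
  ext y
  rw [Set.mem_smul_set_iff_inv_smul_mem]
  rfl

/-- The space `L²(K)`. -/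
abbrev L2 (K : Type*) [Field K] [ValuativeRel K] [TopologicalSpace K]
    [IsNonarchimedeanLocalField K] [MeasurableSpace K] [BorelSpace K] : Type _ :=
  Lp ℂ 2 (haarK K)

theorem memLp_quasiRegular (r : AffineGroup K) (f : L2 K) :
    MemLp (fun y : K => ((absv (r.2 : K) : ℝ) ^ (-(1 / 2) : ℝ)) •
      f (((r.2⁻¹ : Kˣ) : K) * (y - r.1))) 2 (haarK K) := by
  have hT : Measurable fun y : K => ((r.2⁻¹ : Kˣ) : K) * (y - r.1) :=
    (continuous_const.mul (continuous_id.sub continuous_const)).measurable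
  have hf : MemLp (f : K → ℂ) 2
      ((haarK K).map fun y : K => ((r.2⁻¹ : Kˣ) : K) * (y - r.1)) := by
    rw [smul_map_affine]
    exact (Lp.memLp f).smul_measure (by simp)
  exact (hf.comp_of_map hT.aemeasurable).const_smul ((absv (r.2 : K) : ℝ) ^ (-(1 / 2) : ℝ))

/-- The quasi-regular representation on `L²(K)`:
`(π(x, h) f)(y) = |h|^(-1/2) f (h⁻¹ (y - x))`. -/
def quasiRegular (r : AffineGroup K) (f : L2 K) : L2 K :=
  (memLp_quasiRegular r f).toLp _

/-- The space `S₀(K)`: locally constant functions of compact support with vanishing integral. -/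
structure IsS0 (g : K → ℂ) : Prop where
  isLocallyConstant : IsLocallyConstant g
  hasCompactSupport : HasCompactSupport g
  integral_eq_zero : ∫ x, g x ∂haarK K = 0

theorem IsS0.memLp {g : K → ℂ} (hg : IsS0 g) : MemLp g 2 (haarK K) :=
  hg.isLocallyConstant.continuous.memLp_of_hasCompactSupport hg.hasCompactSupport

/-- An element of `S₀(K)` as an element of `L²(K)`. -/
def IsS0.toL2 {g : K → ℂ} (hg : IsS0 g) : L2 K := hg.memLp.toLp g

/-- The wavelet transform `W_g f (r) = ⟨f | π(r) g⟩`, linear in `f`. -/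
def waveletTransform (g f : L2 K) (r : AffineGroup K) : ℂ := inner ℂ (quasiRegular r g) f

/-- The additive character `χ` is continuous, and the ring of integers is its conductor: it is the
set of all `x` such that `χ` is trivial on `x 𝒪`. In particular `x ↦ χ(x ·)` identifies `K` with
its dual group and `haarK` is self-dual. -/
def IsStandardCharacter (χ : AddChar K Circle) : Prop :=
  Continuous χ ∧
    ∀ x : K, (∀ y : K, valuation K y ≤ 1 → χ (x * y) = 1) ↔ valuation K x ≤ 1

/-- The integrand `|ĝ(ξ)|² / |ξ|` of the admissibility constant, with
`ĝ(ξ) = ∫ g(v) χ(-v ξ) dv`. -/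
def admissibilityDensity (χ : AddChar K Circle) (g : K → ℂ) (ξ : K) : ℝ :=
  ‖Fourier.fourierIntegral χ (haarK K) g ξ‖ ^ 2 / (absv ξ : ℝ)

/-- The admissibility constant `C_g = ∫ |ĝ(ξ)|² / |ξ| dξ`. -/
def admissibilityConst (χ : AddChar K Circle) (g : K → ℂ) : ℝ :=
  ∫ ξ, admissibilityDensity χ g ξ ∂haarK K

end Wavelets

/-- The family `v` is a tight frame of `E` with frame constant `A`. -/
def IsTightFrame {ι E : Type*} [NormedAddCommGroup E] [InnerProductSpace ℂ E]
    (v : ι → E) (A : ℝ) : Prop :=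
  0 < A ∧ ∀ f : E, HasSum (fun i => ‖inner ℂ (v i) f‖ ^ 2) (A * ‖f‖ ^ 2)

end

end LocalFieldWavelet

namespace LocalFieldWavelet

open scoped Pointwise

/-! For fixed h, the function x ↦ ⟨f | π(x,h)g⟩ is |h|^(-1/2) times the correlation of f with the
dilate g(h⁻¹ ·). Its Fourier transform is therefore a product (`fourierIntegral_correlation`), and
Plancherel turns its squared norm, weighted by |h|⁻¹, into ∫ |f̂(ξ)|² |ĝ(hξ)|² dξ: the powers of |h|
from the representation, the dilation and the measure of G cancel. Integrating over h first,
invariance of d*h gives C_g for every ξ ≠ 0, and Plancherel for f yields C_g ‖f‖².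

The Fourier analysis is needed only for step functions: functions invariant under c𝒪 and supported
in d𝒪. The transform exchanges the two conditions (`IsStep.fourierIntegral`), so inversion and
Plancherel are elementary, and C_g is finite because ĝ vanishes near 0. Density of step functions
and Fatou's lemma extend the norm identity to L² (`eLpNorm_inner_eq_of_dense`).

Since H fixes g, the wavelet transform is constant on each coset rH, so its integral over G is μ(H)
times a sum over R (`lintegral_haarAffine_eq_tsum`). This is the tight frame identity; the expansion
says that the normalized analysis operator U satisfies U*U = 1 (`IsTightFrame.hasSum`). -/

open Filter Topology in
/-- A non-archimedean local field is Hausdorff and second countable. -/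
theorem t2Space_and_secondCountableTopology (K : Type*) [Field K] [ValuativeRel K]
    [TopologicalSpace K] [IsNonarchimedeanLocalField K] :
    T2Space K ∧ SecondCountableTopology K := by
  let _ := IsTopologicalAddGroup.rightUniformSpace K
  have := isUniformAddGroup_of_addCommGroup (G := K)
  -- Embedding the value group in the reals makes K a nontrivially normed field; being locally
  -- compact, it is then proper.
  let _ : (Valued.v (R := K) (Γ₀ := ValueGroupWithZero K)).RankOne :=
  { hom' := IsRankLeOne.nonempty.some.emb (R := K).comp MonoidWithZeroHom.ValueGroup₀.embedding
    strictMono' := IsRankLeOne.nonempty.some.strictMono.comp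
        MonoidWithZeroHom.ValueGroup₀.embedding_strictMono }
  open scoped Valued in
  have : ProperSpace K := .of_nontriviallyNormedField_of_weaklyLocallyCompactSpace K
  open scoped Valued in
  exact ⟨inferInstance, secondCountable_of_proper⟩

/-! ### Fractional ideals, the modulus and Haar measure of K -/

section Field

set_option linter.unusedSectionVars false

variable {K : Type*} [Field K] [ValuativeRel K] [TopologicalSpace K]
  [IsNonarchimedeanLocalField K]

instance : T2Space K := (t2Space_and_secondCountableTopology K).1

instance : SecondCountableTopology K := (t2Space_and_secondCountableTopology K).2

/-- The fractional ideal `c 𝒪`, as an additive subgroup of `K`. -/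
def ball (c : K) : AddSubgroup K where
  carrier := {x | valuation K x ≤ valuation K c}
  add_mem' hx hy := by
    rw [Set.mem_ofPred_eq] at *
    exact (valuation K).map_add_le hx hy
  zero_mem' := by simp
  neg_mem' hx := by simpa using hx

theorem mem_ball {c x : K} : x ∈ ball c ↔ valuation K x ≤ valuation K c :=
  Set.mem_ofPred_eq ▸ Iff.rfl

theorem valuation_pos {c : K} (hc : c ≠ 0) : 0 < valuation K c := by
  simpa [zero_lt_iff] using hc

theorem mul_mem_ball_mul {a c x : K} (ha : a ≠ 0) : a * x ∈ ball (a * c) ↔ x ∈ ball c := by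
  simp only [mem_ball, map_mul]
  exact mul_le_mul_iff_right₀ (valuation_pos ha)

theorem mem_ball_inv {c x : K} (hc : c ≠ 0) : x ∈ ball c⁻¹ ↔ valuation K (c * x) ≤ 1 := by
  rw [← mul_mem_ball_mul hc, mul_inv_cancel₀ hc, mem_ball, map_one]

theorem ball_mono {c d : K} (h : valuation K c ≤ valuation K d) : ball c ≤ ball d :=
  fun _ hx => mem_ball.mpr (le_trans (mem_ball.mp hx) h)

theorem isCompact_ball (c : K) : IsCompact (ball c : Set K) := by
  convert IsNonarchimedeanLocalField.isCompact_closedBall K (valuation K c) using 1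
  ext x; simp [mem_ball]

theorem ball_mem_nhds {c : K} (hc : c ≠ 0) : (ball c : Set K) ∈ nhds 0 :=
  (IsValuativeTopology.hasBasis_nhds_zero' K).mem_iff.mpr
    ⟨valuation K c, (valuation_pos hc).ne', fun _ hx => mem_ball.mpr (le_of_lt (by simpa using hx))⟩

theorem isOpen_ball {c : K} (hc : c ≠ 0) : IsOpen (ball c : Set K) :=
  (ball c).isOpen_of_mem_nhds (ball_mem_nhds hc)

theorem exists_ball_subset {s : Set K} (hs : s ∈ nhds 0) :
    ∃ c : K, c ≠ 0 ∧ (ball c : Set K) ⊆ s := by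
  obtain ⟨γ, hγ, h⟩ := (IsValuativeTopology.hasBasis_nhds_zero' K).mem_iff.mp hs
  obtain ⟨a, rfl⟩ := ValuativeRel.valuation_surjective γ
  -- Basic neighbourhoods are given by strict inequalities and balls by weak ones; the factor p with
  -- |p| < 1 makes up the difference.
  obtain ⟨p, hp, hp1⟩ := Valuation.IsNontrivial.exists_lt_one (v := valuation K)
  have ha : a ≠ 0 := by simpa using hγ
  refine ⟨a * p, mul_ne_zero ha hp, fun x hx => h ?_⟩
  rw [Set.mem_ofPred_eq]
  refine lt_of_le_of_lt (mem_ball.mp hx) ?_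
  rw [map_mul]
  exact mul_lt_of_lt_one_right (valuation_pos ha) hp1

theorem exists_subset_ball {s : Set K} (hs : IsCompact s) :
    ∃ d : K, d ≠ 0 ∧ s ⊆ ball d := by
  have hdir : Directed (· ⊆ ·) fun d : {d : K // d ≠ 0} => (ball d.1 : Set K) := by
    intro a b
    rcases le_total (valuation K a.1) (valuation K b.1) with h | h
    · exact ⟨b, ball_mono h, le_rfl⟩
    · exact ⟨a, le_rfl, ball_mono h⟩
  have : Nonempty {d : K // d ≠ 0} := ⟨1, one_ne_zero⟩
  obtain ⟨d, hd⟩ := hs.elim_directed_cover _ (fun d => isOpen_ball d.2) (fun x _ => by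
    by_cases hx : x = 0
    · exact Set.mem_iUnion.mpr ⟨⟨1, one_ne_zero⟩, by rw [hx]; exact (ball (1 : K)).zero_mem⟩
    · exact Set.mem_iUnion.mpr ⟨⟨x, hx⟩, mem_ball.mpr le_rfl⟩) hdir
  exact ⟨d, d.2, hd⟩

theorem absv_zero : absv (0 : K) = 0 := by simp [absv]

theorem absv_pos {x : K} (hx : x ≠ 0) : 0 < absv x := absv_units_pos (Units.mk0 x hx)

theorem absv_mul {x y : K} : absv (x * y) = absv x * absv y := by
  by_cases hx : x = 0
  · simp [hx, absv_zero]
  by_cases hy : y = 0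
  · simp [hy, absv_zero]
  have := map_mul (distribHaarChar K) (Units.mk0 x hx) (Units.mk0 y hy)
  simpa [← absv_units] using this

theorem absv_one : absv (1 : K) = 1 := by
  simpa using absv_units (1 : Kˣ)

theorem absv_inv {x : K} : absv x⁻¹ = (absv x)⁻¹ := by
  by_cases hx : x = 0
  · simp [hx, absv_zero]
  · refine eq_inv_of_mul_eq_one_left ?_
    rw [← absv_mul, inv_mul_cancel₀ hx, absv_one]

theorem coe_absv_inv {x : K} (hx : x ≠ 0) :
    ((absv x⁻¹ : ℝ≥0) : ℝ≥0∞) = ((absv x : ℝ≥0) : ℝ≥0∞)⁻¹ := by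
  rw [absv_inv, ENNReal.coe_inv (absv_pos hx).ne']

variable [MeasurableSpace K] [BorelSpace K]

theorem map_affine_eq (x : K) {a : K} (ha : a ≠ 0) :
    (haarK K).map (fun y => a⁻¹ * (y - x)) = absv a • haarK K := by
  simpa using smul_map_affine x (Units.mk0 a ha)

theorem lintegral_comp_affine (x : K) {a : K} (ha : a ≠ 0) {φ : K → ℝ≥0∞} (hφ : Measurable φ) :
    ∫⁻ y, φ (a⁻¹ * (y - x)) ∂haarK K = absv a * ∫⁻ y, φ y ∂haarK K := by
  rw [← lintegral_map hφ (by fun_prop), map_affine_eq x ha, lintegral_smul_measure]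
  rfl

theorem lintegral_comp_mul {a : K} (ha : a ≠ 0) {φ : K → ℝ≥0∞} (hφ : Measurable φ) :
    ∫⁻ y, φ (a * y) ∂haarK K = (absv a : ℝ≥0∞)⁻¹ * ∫⁻ y, φ y ∂haarK K := by
  simpa [coe_absv_inv ha] using lintegral_comp_affine 0 (inv_ne_zero ha) hφ

/-- Dilation by c carries 𝒪, of measure one, onto c𝒪. This links `absv`, defined by scaling of
measure, with the valuation. -/
theorem haarK_ball {c : K} (hc : c ≠ 0) : haarK K (ball c) = absv c := by
  have h := lintegral_comp_affine (0 : K) hc (φ := Set.indicator (ball (1 : K)) 1)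
    (measurable_one.indicator (isOpen_ball one_ne_zero).measurableSet)
  rw [lintegral_indicator_one (isOpen_ball one_ne_zero).measurableSet] at h
  have h1 : haarK K (ball (1 : K)) = 1 := by
    convert haarK_integers (K := K) using 2
    ext x; simp [mem_ball]
  rw [h1, mul_one] at h
  rw [← h, ← lintegral_indicator_one (isOpen_ball hc).measurableSet]
  congr 1
  ext y
  have : c⁻¹ * (y - 0) ∈ ball (1 : K) ↔ y ∈ ball c := by
    rw [← mul_mem_ball_mul hc]; simp [hc]
  by_cases hy : y ∈ ball c
  · rw [Set.indicator_of_mem (this.mpr hy), Set.indicator_of_mem hy]; rfl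
  · rw [Set.indicator_of_notMem (mt this.mp hy), Set.indicator_of_notMem hy]

theorem haarK_ball_lt_top (c : K) : haarK K (ball c) < ∞ := (isCompact_ball c).measure_lt_top

theorem absv_mono {x y : K} (h : valuation K x ≤ valuation K y) : absv x ≤ absv y := by
  by_cases hx : x = 0
  · simp [hx, absv_zero]
  have hy : y ≠ 0 := by
    rintro rfl
    simp [hx] at h
  have := measure_mono (μ := haarK K) (show (ball x : Set K) ⊆ ball y from ball_mono h)
  rwa [haarK_ball hx, haarK_ball hy, ENNReal.coe_le_coe] at this

/-- The point lies in every ideal pⁿ𝒪, of measure |p|ⁿ, and |p| < 1. It allows ξ = 0 to be ignored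
and Kˣ to be treated as almost all of K. -/
theorem haarK_singleton_zero : haarK K {(0 : K)} = 0 := by
  obtain ⟨p, hp, hp1⟩ := Valuation.IsNontrivial.exists_lt_one (v := valuation K)
  have key : ∀ n : ℕ, haarK K {(0 : K)} ≤ (absv p : ℝ≥0∞) ^ n := by
    intro n
    have h : (absv (p ^ n) : ℝ≥0) = absv p ^ n := by
      induction n with
      | zero => simp [absv_one]
      | succ k ih => rw [pow_succ, absv_mul, ih, pow_succ]
    rw [← ENNReal.coe_pow, ← h, ← haarK_ball (pow_ne_zero n hp)]
    exact measure_mono (by simp)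
  have hlt : absv p < 1 := by
    have hle : absv p ≤ 1 := by
      rw [← absv_one (K := K)]; exact absv_mono (by simpa using hp1.le)
    refine lt_of_le_of_ne hle fun h => ?_
    -- otherwise `𝒪` and `p 𝒪` have the same measure, although `1 + p 𝒪` is a disjoint translate
    have hd : Disjoint (ball p : Set K) ((1 : K) +ᵥ (ball p : Set K)) := by
      rw [Set.disjoint_left]
      rintro x hx ⟨y, hy, rfl⟩
      have : (1 : K) ∈ ball p := by
        have := (ball p).sub_mem hx hy
        simpa using this
      rw [mem_ball, map_one] at this
      exact absurd this (not_le.mpr hp1)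
    have hsub : (ball p : Set K) ∪ ((1 : K) +ᵥ (ball p : Set K)) ⊆ ball (1 : K) := by
      have hle : ball p ≤ ball (1 : K) := ball_mono (by simpa using hp1.le)
      rintro x (hx | ⟨y, hy, rfl⟩)
      · exact hle hx
      · exact (ball (1 : K)).add_mem (mem_ball.mpr le_rfl) (hle hy)
    have := measure_mono (μ := haarK K) hsub
    rw [measure_union hd ((isOpen_ball hp).vadd (1 : K)).measurableSet, measure_vadd,
      haarK_ball hp, haarK_ball one_ne_zero, h, absv_one] at this
    norm_num at this
  refine le_antisymm (ge_of_tendsto' (ENNReal.tendsto_pow_atTop_nhds_zero_of_lt_one ?_) key) bot_le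
  exact_mod_cast hlt

/-- Away from 0 the valuation is locally constant, and `absv` is monotone in it. -/
theorem measurable_absv : Measurable (absv : K → ℝ≥0) := by
  refine measurable_of_continuousOn_compl_singleton 0 fun x hx => ?_
  refine ContinuousAt.continuousWithinAt (Filter.EventuallyEq.continuousAt (y := absv x) ?_)
  have hx : x ≠ 0 := hx
  have h := Valuation.locally_const (v := valuation K) (x := x)
    (valuation_pos hx).ne'
  filter_upwards [h] with y hy
  exact le_antisymm (absv_mono hy.le) (absv_mono hy.ge)

end Field
-- Step functions, their Fourier transform and correlations
section Step

set_option linter.unusedSectionVars false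

variable {K : Type*} [Field K] [ValuativeRel K] [TopologicalSpace K]
  [IsNonarchimedeanLocalField K]

/-- `f` is invariant under translations by `c 𝒪` and vanishes outside `d 𝒪`. -/
structure IsStep (f : K → ℂ) (c d : K) : Prop where
  map_add : ∀ u ∈ ball c, ∀ x, f (x + u) = f x
  eq_zero : ∀ x, x ∉ ball d → f x = 0

/-- Compactness of the support makes the radius of local constancy uniform. -/
theorem exists_isStep {f : K → ℂ} (hf : IsLocallyConstant f) (hfc : HasCompactSupport f) :
    ∃ c d : K, c ≠ 0 ∧ d ≠ 0 ∧ IsStep f c d := by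
  obtain ⟨d, hd, hsub⟩ := exists_subset_ball hfc
  have key : ∀ᶠ u in nhds (0 : K), ∀ x ∈ (ball d : Set K), f (x + u) = f x := by
    refine (isCompact_ball d).eventually_forall_of_forall_eventually fun y _ => ?_
    have h1 : ∀ᶠ z : K × K in nhds (0, y), f (z.2 + z.1) = f y := by
      have ht : Filter.Tendsto (fun z : K × K => z.2 + z.1) (nhds (0, y)) (nhds y) := by
        have : Continuous fun z : K × K => z.2 + z.1 := by fun_prop
        simpa using this.tendsto (0, y)
      exact ht.eventually ((hf.isOpen_fiber (f y)).mem_nhds rfl)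
    have h2 : ∀ᶠ z : K × K in nhds (0, y), f z.2 = f y :=
      (continuous_snd.tendsto (0, y)).eventually ((hf.isOpen_fiber (f y)).mem_nhds rfl)
    filter_upwards [h1, h2] with z hz1 hz2
    rw [hz1, hz2]
  obtain ⟨c, hc, hcs⟩ := exists_ball_subset key
  have hz : ∀ x, x ∉ ball d → f x = 0 := fun x hx =>
    image_eq_zero_of_notMem_tsupport fun h => hx (hsub h)
  refine ⟨c, d, hc, hd, ⟨fun u hu x => ?_, hz⟩⟩
  by_cases hx : x ∈ ball d
  · exact hcs hu x hx
  -- Translation by u can enter the support from outside; then the invariance is applied at x + u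
  -- with −u.
  by_cases hxu : x + u ∈ ball d
  · have := hcs ((ball c).neg_mem hu) (x + u) hxu
    simpa using this.symm
  · rw [hz _ hx, hz _ hxu]

namespace IsStep

variable {f g : K → ℂ} {c d e : K}

theorem mono (hf : IsStep f c d) (h : ball d ≤ ball e) : IsStep f c e :=
  ⟨hf.map_add, fun x hx => hf.eq_zero x fun hx' => hx (h hx')⟩

theorem isLocallyConstant (hf : IsStep f c d) (hc : c ≠ 0) : IsLocallyConstant f := by
  refine (IsLocallyConstant.iff_eventually_eq f).mpr fun x => ?_
  have : Filter.Tendsto (fun y => y - x) (nhds x) (nhds 0) := by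
    have h : Continuous fun y => y - x := by fun_prop
    simpa using h.tendsto x
  filter_upwards [this.eventually (ball_mem_nhds hc)] with y hy
  have := hf.map_add _ hy x
  simpa using this

theorem hasCompactSupport (hf : IsStep f c d) : HasCompactSupport f :=
  HasCompactSupport.intro (isCompact_ball d) hf.eq_zero

theorem continuous (hf : IsStep f c d) (hc : c ≠ 0) : Continuous f :=
  (hf.isLocallyConstant hc).continuous

variable [MeasurableSpace K] [BorelSpace K]

theorem integrable (hf : IsStep f c d) (hc : c ≠ 0) : Integrable f (haarK K) :=
  (hf.continuous hc).integrable_of_hasCompactSupport hf.hasCompactSupport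

theorem integrable_norm_sq (hf : IsStep f c d) (hc : c ≠ 0) :
    Integrable (fun x => ‖f x‖ ^ 2) (haarK K) :=
  ((hf.continuous hc).norm.pow 2).integrable_of_hasCompactSupport
    (HasCompactSupport.intro (isCompact_ball d) fun x hx => by simp [hf.eq_zero x hx])

end IsStep

theorem isStep_indicator_ball (c : K) : IsStep (Set.indicator (ball c : Set K) 1) c c where
  map_add u hu x := by
    by_cases hx : x ∈ ball c
    · rw [Set.indicator_of_mem hx, Set.indicator_of_mem (show x + u ∈ ball c from
        (ball c).add_mem hx hu)]; rfl
    · rw [Set.indicator_of_notMem hx, Set.indicator_of_notMem]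
      exact fun h => hx ((add_mem_cancel_right hu).mp h)
  eq_zero x hx := Set.indicator_of_notMem hx 1

variable [MeasurableSpace K] [BorelSpace K] {χ : AddChar K Circle}

theorem IsStandardCharacter.apply_eq_one (hχ : IsStandardCharacter χ) {x : K}
    (hx : valuation K x ≤ 1) : χ x = 1 := by
  simpa using (hχ.2 1).mpr (by simp) x hx

theorem IsStandardCharacter.apply_mul_eq_one (hχ : IsStandardCharacter χ) {d x y : K}
    (hd : d ≠ 0) (hx : x ∈ ball d) (hy : y ∈ ball d⁻¹) : χ (x * y) = 1 := by
  refine hχ.apply_eq_one ?_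
  rw [map_mul]
  rw [mem_ball] at hx hy
  refine (mul_le_mul' hx hy).trans ?_
  rw [← map_mul, mul_inv_cancel₀ hd, map_one]

local notation "𝓕[" χ "]" => Fourier.fourierIntegral χ (haarK _)

namespace IsStep

variable {f g : K → ℂ} {c d : K}

/-- The Fourier transform exchanges the roles of support and invariance. -/
theorem fourierIntegral (hχ : IsStandardCharacter χ) (hf : IsStep f c d) (hc : c ≠ 0)
    (hd : d ≠ 0) : IsStep (𝓕[χ] f) d⁻¹ c⁻¹ where
  map_add u hu x := by
    rw [Fourier.fourierIntegral_def, Fourier.fourierIntegral_def]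
    congr 1
    ext v
    by_cases hv : v ∈ ball d
    · congr 1
      rw [mul_add, neg_add, AddChar.map_add_eq_mul, AddChar.map_neg_eq_inv χ (v * u),
        hχ.apply_mul_eq_one hd hv hu, inv_one, mul_one]
    · simp [hf.eq_zero v hv]
  eq_zero x hx := by
    -- Outside c⁻¹𝒪 the conductor condition yields y ∈ 𝒪 with χ(cxy) ≠ 1. Translation by cy fixes f
    -- but multiplies its transform at x by χ(cxy), so that value is 0.
    rw [mem_ball_inv hc, ← hχ.2] at hx
    push Not at hx
    obtain ⟨y, hy, hne⟩ := hx
    have hu : c * y ∈ ball c := by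
      rw [mem_ball, map_mul]
      exact mul_le_of_le_one_right' hy
    have h := congrFun (VectorFourier.fourierIntegral_comp_add_right χ (haarK K)
      (LinearMap.mul K K) f (c * y)) x
    have h2 : (f ∘ fun v => v + c * y) = f := funext fun v => hf.map_add _ hu v
    rw [h2] at h
    have h3 : ((χ (c * x * y) : ℂ) - 1) * 𝓕[χ] f x = 0 := by
      rw [sub_mul, one_mul, sub_eq_zero]
      rw [LinearMap.mul_apply', mul_right_comm, Circle.smul_def, smul_eq_mul] at h
      exact h.symm
    refine (mul_eq_zero.mp h3).resolve_left fun h4 => hne ?_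
    exact Circle.ext (by simpa [sub_eq_zero] using h4)

end IsStep

theorem fourierIntegral_zero (f : K → ℂ) : 𝓕[χ] f 0 = ∫ x, f x ∂haarK K := by
  simp [Fourier.fourierIntegral_def]

theorem fourierIntegral_indicator_ball (hχ : IsStandardCharacter χ) {c : K} (hc : c ≠ 0) :
    𝓕[χ] (Set.indicator (ball c : Set K) 1)
      = Set.indicator (ball c⁻¹ : Set K) (fun _ => ((absv c : ℝ) : ℂ)) := by
  have h := (isStep_indicator_ball c).fourierIntegral hχ hc hc
  ext x
  by_cases hx : x ∈ ball c⁻¹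
  · have h1 := h.map_add x hx 0
    rw [zero_add, fourierIntegral_zero, show (1 : K → ℂ) = fun _ => 1 from rfl,
      integral_indicator_const _ (isOpen_ball hc).measurableSet, measureReal_def, haarK_ball hc] at h1
    rw [show (1 : K → ℂ) = fun _ => 1 from rfl, h1, Set.indicator_of_mem hx]
    simp
  · rw [h.eq_zero x hx, Set.indicator_of_notMem hx]

/-- Fourier inversion for locally constant functions of compact support. -/
theorem fourierIntegral_fourierIntegral (hχ : IsStandardCharacter χ) {f : K → ℂ} {c d : K}
    (hf : IsStep f c d) (hc : c ≠ 0) (hd : d ≠ 0) (x : K) :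
    𝓕[χ] (𝓕[χ] f) x = f (-x) := by
  have hF := hf.fourierIntegral hχ hc hd
  -- The transform of f lives on c⁻¹𝒪, so a cutoff there costs nothing. Moving the outer transform
  -- onto the modulated cutoff B gives |c|⁻¹ times the indicator of −x + c𝒪, a set of measure |c| on
  -- which f equals f(−x).
  set B : K → ℂ := fun ξ => χ (-(ξ * x)) • Set.indicator (ball c⁻¹ : Set K) 1 ξ with hB
  have hBint : Integrable B (haarK K) := by
    have := (VectorFourier.fourierIntegral_convergent_iff (μ := haarK K) (f :=
      Set.indicator (ball c⁻¹ : Set K) (1 : K → ℂ)) (L := LinearMap.mul K K) hχ.1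
      (by simp only [LinearMap.mul_apply']; fun_prop) x).2
      ((isStep_indicator_ball c⁻¹).integrable (inv_ne_zero hc))
    exact this
  have hBhat : ∀ v, 𝓕[χ] B v = Set.indicator (ball c : Set K) (fun _ => ((absv c⁻¹ : ℝ) : ℂ))
      (v + x) := by
    intro v
    have := congrFun (fourierIntegral_indicator_ball hχ (inv_ne_zero hc)) (v + x)
    rw [inv_inv] at this
    rw [← this, Fourier.fourierIntegral_def, Fourier.fourierIntegral_def]
    congr 1
    ext ξ
    rw [hB, smul_smul, ← AddChar.map_add_eq_mul]
    ring_nf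
  have h1 : 𝓕[χ] (𝓕[χ] f) x = ∫ ξ, 𝓕[χ] f ξ • B ξ ∂haarK K := by
    rw [Fourier.fourierIntegral_def]
    congr 1
    ext ξ
    by_cases hξ : ξ ∈ ball c⁻¹
    · simp [hB, Set.indicator_of_mem (show ξ ∈ (ball c⁻¹ : Set K) from hξ), Circle.smul_def,
        mul_comm]
    · simp [hF.eq_zero ξ hξ]
  have h2 : ∫ ξ, 𝓕[χ] f ξ • B ξ ∂haarK K = ∫ v, f v • 𝓕[χ] B v ∂haarK K := by
    have := VectorFourier.integral_fourierIntegral_smul_eq_flip (μ := haarK K) (ν := haarK K)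
      (L := LinearMap.mul K K) (f := f) (g := B) hχ.1
      (by simp only [LinearMap.mul_apply']; fun_prop) (hf.integrable hc) hBint
    have hflip : (LinearMap.mul K K).flip = LinearMap.mul K K := by
      ext; simp
    rw [hflip] at this
    exact this
  have h3 : (fun v => f v • 𝓕[χ] B v)
      = fun v => Set.indicator (ball c : Set K) (fun _ => f (-x) * ((absv c⁻¹ : ℝ) : ℂ))
        (v + x) := by
    ext v
    rw [hBhat]
    by_cases hv : v + x ∈ ball c
    · have := hf.map_add _ hv (-x)
      rw [neg_add_cancel_comm_assoc] at this
      rw [Set.indicator_of_mem hv, Set.indicator_of_mem hv, this, smul_eq_mul]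
    · rw [Set.indicator_of_notMem hv, Set.indicator_of_notMem hv, smul_zero]
  rw [h1, h2, h3, integral_add_right_eq_self (μ := haarK K)
    (Set.indicator (ball c : Set K) (fun _ => f (-x) * ((absv c⁻¹ : ℝ) : ℂ))) x,
    integral_indicator_const _ (isOpen_ball hc).measurableSet, measureReal_def, haarK_ball hc,
    absv_inv]
  have : ((absv c : ℝ) : ℂ) ≠ 0 := by exact_mod_cast (absv_pos hc).ne'
  simp only [ENNReal.coe_toReal, NNReal.coe_inv, Complex.ofReal_inv, Complex.real_smul]
  field_simp

theorem integral_norm_sq_fourierIntegral (hχ : IsStandardCharacter χ) {f : K → ℂ} {c d : K}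
    (hf : IsStep f c d) (hc : c ≠ 0) (hd : d ≠ 0) :
    ∫ ξ, ‖𝓕[χ] f ξ‖ ^ 2 ∂haarK K = ∫ x, ‖f x‖ ^ 2 ∂haarK K := by
  have hF := hf.fourierIntegral hχ hc hd
  have h := VectorFourier.integral_sesq_fourierIntegral_eq_neg_flip (μ := haarK K)
    (ν := haarK K) (L := LinearMap.mul K K) (f := f) (g := 𝓕[χ] f) (innerSL ℂ) hχ.1
    (by simp only [LinearMap.mul_apply']; fun_prop) (hf.integrable hc)
    (hF.integrable (inv_ne_zero hd))
  -- The sesquilinear multiplication formula puts the inverse transform on the second factor, where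
  -- inversion returns f.
  have h2 : ∀ x, VectorFourier.fourierIntegral χ (haarK K) (-(LinearMap.mul K K).flip)
      (𝓕[χ] f) x = f x := by
    intro x
    have := fourierIntegral_fourierIntegral hχ hf hc hd (-x)
    rw [neg_neg] at this
    rw [← this, Fourier.fourierIntegral_def, VectorFourier.fourierIntegral]
    simp
  simp only [h2, innerSL_apply_apply] at h
  have h3 : ∀ z : ℂ, inner ℂ z z = ((‖z‖ ^ 2 : ℝ) : ℂ) := fun z => by
    rw [inner_self_eq_norm_sq_to_K]; simp
  change ∫ ξ, inner ℂ (𝓕[χ] f ξ) (𝓕[χ] f ξ) ∂haarK K = _ at h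
  simp only [h3] at h
  rw [integral_complex_ofReal, integral_complex_ofReal] at h
  exact_mod_cast h

theorem IsStep.lintegral_enorm_sq {f : K → ℂ} {c d : K} (hf : IsStep f c d) (hc : c ≠ 0) :
    ∫⁻ x, ‖f x‖ₑ ^ 2 ∂haarK K = ENNReal.ofReal (∫ x, ‖f x‖ ^ 2 ∂haarK K) := by
  rw [ofReal_integral_eq_lintegral_ofReal (hf.integrable_norm_sq hc)
    (Filter.Eventually.of_forall fun x => by positivity)]
  simp [ENNReal.ofReal_pow]

/-- Plancherel's formula for locally constant functions of compact support. -/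
theorem lintegral_enorm_sq_fourierIntegral (hχ : IsStandardCharacter χ) {f : K → ℂ} {c d : K}
    (hf : IsStep f c d) (hc : c ≠ 0) (hd : d ≠ 0) :
    ∫⁻ ξ, ‖𝓕[χ] f ξ‖ₑ ^ 2 ∂haarK K = ∫⁻ x, ‖f x‖ₑ ^ 2 ∂haarK K := by
  rw [hf.lintegral_enorm_sq hc,
    (hf.fourierIntegral hχ hc hd).lintegral_enorm_sq (inv_ne_zero hd),
    integral_norm_sq_fourierIntegral hχ hf hc hd]

/-- The correlation `x ↦ ∫ f(y) conj (g (y - x)) dy`. -/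
noncomputable def correlation (f g : K → ℂ) (x : K) : ℂ :=
  ∫ y, f y * starRingEnd ℂ (g (y - x)) ∂haarK K

theorem IsStep.correlation {f g : K → ℂ} {c c' d : K} (hf : IsStep f c d) (hg : IsStep g c' d) :
    IsStep (correlation f g) c d where
  map_add u hu x := by
    rw [LocalFieldWavelet.correlation, LocalFieldWavelet.correlation,
      ← integral_add_right_eq_self (μ := haarK K) _ u]
    congr 1
    ext y
    rw [hf.map_add u hu, add_sub_add_right_eq_sub]
  eq_zero x hx := by
    rw [LocalFieldWavelet.correlation]
    refine integral_eq_zero_of_ae (Filter.Eventually.of_forall fun y => ?_)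
    by_cases hy : y ∈ ball d
    · have : y - x ∉ ball d := fun h => hx (by
        have := (ball d).sub_mem hy h
        rwa [sub_sub_cancel] at this)
      simp [hg.eq_zero _ this]
    · simp [hf.eq_zero y hy]

theorem fourierIntegral_correlation (hχ : IsStandardCharacter χ) {f g : K → ℂ}
    (hf : Integrable f (haarK K)) (hg : Integrable g (haarK K)) (ξ : K) :
    𝓕[χ] (correlation f g) ξ = 𝓕[χ] f ξ * starRingEnd ℂ (𝓕[χ] g ξ) := by
  have hL : Continuous fun p : K × K => LinearMap.mul K K p.1 p.2 := by
    simp only [LinearMap.mul_apply']; fun_prop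
  -- With the character absorbed into both factors, the transform at ξ is the integral of a
  -- convolution, hence a product of integrals.
  set G : K → ℂ := fun t => starRingEnd ℂ (χ (-(-t * ξ)) • g (-t)) with hG
  have h1 : Integrable (fun v => χ (-(v * ξ)) • f v) (haarK K) :=
    (VectorFourier.fourierIntegral_convergent_iff hχ.1 hL ξ).2 hf
  have h2 : Integrable (fun v => χ (-(v * ξ)) • g v) (haarK K) :=
    (VectorFourier.fourierIntegral_convergent_iff hχ.1 hL ξ).2 hg
  have hGint : Integrable G (haarK K) := by
    have h3 := (LinearIsometryEquiv.integrable_comp_iff (Complex.conjLIE)).mpr h2.comp_neg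
    exact h3
  have h := integral_convolution (μ := haarK K) (ν := haarK K) (ContinuousLinearMap.mul ℂ ℂ)
    h1 hGint
  have hGi : ∫ x, G x ∂haarK K = starRingEnd ℂ (𝓕[χ] g ξ) := by
    rw [hG, integral_conj,
      integral_neg_eq_self (μ := haarK K) (fun t => χ (-(t * ξ)) • g t)]
    rfl
  rw [hGi, ContinuousLinearMap.mul_apply', ← Fourier.fourierIntegral_def] at h
  rw [← h, Fourier.fourierIntegral_def]
  congr 1
  ext x
  rw [convolution_def, correlation, Circle.smul_def, smul_eq_mul, ← integral_const_mul]
  congr 1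
  ext t
  have h4 : χ (-(x * ξ)) = χ (-(t * ξ)) * (χ (-(-(x - t) * ξ)))⁻¹ := by
    rw [← AddChar.map_neg_eq_inv, ← AddChar.map_add_eq_mul]
    ring_nf
  rw [ContinuousLinearMap.mul_apply', hG, h4]
  simp only [Circle.smul_def, smul_eq_mul, map_mul, Circle.coe_mul, Circle.coe_inv_eq_conj,
    neg_sub]
  ring

theorem lintegral_enorm_sq_correlation (hχ : IsStandardCharacter χ) {f g : K → ℂ}
    {c d c' d' : K} (hf : IsStep f c d) (hg : IsStep g c' d') (hc : c ≠ 0) (hd : d ≠ 0)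
    (hc' : c' ≠ 0) (hd' : d' ≠ 0) :
    ∫⁻ x, ‖correlation f g x‖ₑ ^ 2 ∂haarK K
      = ∫⁻ ξ, ‖𝓕[χ] f ξ‖ₑ ^ 2 * ‖𝓕[χ] g ξ‖ₑ ^ 2 ∂haarK K := by
  obtain ⟨e, he, h1, h2⟩ : ∃ e : K, e ≠ 0 ∧ ball d ≤ ball e ∧ ball d' ≤ ball e := by
    rcases le_total (valuation K d) (valuation K d') with h | h
    · exact ⟨d', hd', ball_mono h, le_rfl⟩
    · exact ⟨d, hd, le_rfl, ball_mono h⟩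
  rw [← lintegral_enorm_sq_fourierIntegral hχ ((hf.mono h1).correlation (hg.mono h2)) hc he]
  congr 1
  ext ξ
  rw [fourierIntegral_correlation hχ (hf.integrable hc) (hg.integrable hc'), enorm_mul,
    RCLike.enorm_conj, mul_pow]

/-- The transform of g is invariant under d⁻¹𝒪 and vanishes at 0 because g has mean zero; so it
vanishes on d⁻¹𝒪, and elsewhere 1/|ξ| is bounded by 1/|d⁻¹|. -/
theorem integrable_admissibilityDensity (hχ : IsStandardCharacter χ) {g : K → ℂ}
    (hg : IsS0 g) : Integrable (admissibilityDensity χ g) (haarK K) := by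
  obtain ⟨c, d, hc, hd, hs⟩ := exists_isStep hg.isLocallyConstant hg.hasCompactSupport
  have hF := hs.fourierIntegral hχ hc hd
  have hd' := inv_ne_zero hd
  refine ((hF.integrable_norm_sq hd').div_const (absv d⁻¹ : ℝ)).mono'
    (((hF.continuous hd').norm.pow 2).measurable.div
      measurable_absv.coe_nnreal_real).aestronglyMeasurable
    (Filter.Eventually.of_forall fun ξ => ?_)
  rw [admissibilityDensity, Real.norm_of_nonneg (by positivity)]
  by_cases hξ : ξ ∈ ball d⁻¹
  · have h0 : 𝓕[χ] g ξ = 0 := by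
      have := hF.map_add ξ hξ 0
      rwa [zero_add, fourierIntegral_zero, hg.integral_eq_zero] at this
    simp [h0]
  · have : (absv d⁻¹ : ℝ) ≤ absv ξ := by
      rw [mem_ball, not_le] at hξ
      exact_mod_cast absv_mono hξ.le
    have hpos : 0 < (absv d⁻¹ : ℝ) := absv_pos hd'
    gcongr

end Step

/-! ### Invariant measures on Kˣ and on the affine group -/

section Haar

set_option linter.unusedSectionVars false

variable {K : Type*} [Field K] [ValuativeRel K] [TopologicalSpace K]
  [IsNonarchimedeanLocalField K] [MeasurableSpace K] [BorelSpace K]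

theorem range_unitsVal : Set.range ((↑) : Kˣ → K) = {0}ᶜ := by
  ext x
  simp only [Set.mem_range, Set.mem_compl_iff, Set.mem_singleton_iff]
  exact ⟨fun ⟨u, hu⟩ => hu ▸ u.ne_zero, fun h => ⟨Units.mk0 x h, rfl⟩⟩

theorem measurableEmbedding_unitsVal : MeasurableEmbedding ((↑) : Kˣ → K) where
  injective := Units.val_injective
  measurable := comap_measurable _
  measurableSet_image' := by
    rintro _ ⟨s, hs, rfl⟩
    rw [Set.image_preimage_eq_inter_range, range_unitsVal]
    exact hs.inter (measurableSet_singleton _).compl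

theorem measurable_unitsVal : Measurable ((↑) : Kˣ → K) := measurableEmbedding_unitsVal.measurable

theorem measurable_absv_unitsVal : Measurable fun h : Kˣ => (absv (h : K) : ℝ≥0∞) :=
  (measurable_absv.comp measurable_unitsVal).coe_nnreal_ennreal

instance : BorelSpace Kˣ := by
  constructor
  have h := (Units.isEmbedding_val₀ (G₀ := K)).eq_induced
  rw [h, borel_comap, ← BorelSpace.measurable_eq (α := K)]
  rfl

instance : SecondCountableTopology Kˣ :=
  (Units.isEmbedding_val₀ (G₀ := K)).isInducing.secondCountableTopology

theorem coe_absv_units_ne_zero (a : Kˣ) : (absv (a : K) : ℝ≥0∞) ≠ 0 :=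
  ENNReal.coe_ne_zero.mpr (absv_units_pos a).ne'

theorem ae_ne_zero : ∀ᵐ x ∂haarK K, x ≠ 0 := by
  simpa [ae_iff] using haarK_singleton_zero (K := K)

theorem map_unitsVal_haarUnits :
    (haarUnits K).map ((↑) : Kˣ → K) = (haarK K).withDensity fun x => ((absv x : ℝ≥0∞))⁻¹ := by
  rw [haarUnits, measurableEmbedding_unitsVal.map_comap, range_unitsVal]
  refine Measure.restrict_eq_self_of_ae_mem ?_
  exact (withDensity_absolutelyContinuous _ _).ae_le ae_ne_zero

theorem lintegral_haarUnits {φ : K → ℝ≥0∞} (hφ : Measurable φ) :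
    ∫⁻ h : Kˣ, φ h ∂haarUnits K = ∫⁻ x, (absv x : ℝ≥0∞)⁻¹ * φ x ∂haarK K := by
  rw [← lintegral_map hφ measurable_unitsVal, map_unitsVal_haarUnits]
  exact lintegral_withDensity_eq_lintegral_mul _ measurable_absv.coe_nnreal_ennreal.inv hφ

/-- Tonelli's theorem over Kˣ needs this. A measurable left inverse of the inclusion exhibits the
measure as the image of a density on K. -/
instance : SFinite (haarUnits K) := by
  obtain ⟨p, hp, hpv⟩ := measurableEmbedding_unitsVal (K := K).exists_measurable_extend
    measurable_id fun _ => ⟨1⟩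
  have : haarUnits K = ((haarUnits K).map ((↑) : Kˣ → K)).map p := by
    rw [Measure.map_map hp measurable_unitsVal, hpv, Measure.map_id]
  rw [this, map_unitsVal_haarUnits]
  infer_instance

/-- The factor |a|⁻¹ from the substitution is offset by 1/|x| = |a|/|ax|: dx/|x| is invariant under
dilations. -/
theorem lintegral_inv_absv_comp_mul {a : K} (ha : a ≠ 0) {φ : K → ℝ≥0∞} (hφ : Measurable φ) :
    ∫⁻ x, (absv x : ℝ≥0∞)⁻¹ * φ (a * x) ∂haarK K
      = ∫⁻ x, (absv x : ℝ≥0∞)⁻¹ * φ x ∂haarK K := by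
  have ha0 : (absv a : ℝ≥0∞) ≠ 0 := ENNReal.coe_ne_zero.mpr (absv_pos ha).ne'
  have h1 : ∀ x : K, (absv x : ℝ≥0∞)⁻¹ * φ (a * x)
      = absv a * ((absv (a * x) : ℝ≥0∞)⁻¹ * φ (a * x)) := by
    intro x
    rw [absv_mul, ENNReal.coe_mul, ENNReal.mul_inv (Or.inl ha0) (Or.inl ENNReal.coe_ne_top),
      ← mul_assoc, ← mul_assoc, ENNReal.mul_inv_cancel ha0 ENNReal.coe_ne_top, one_mul]
  have hm : Measurable fun x : K => (absv x : ℝ≥0∞)⁻¹ * φ x :=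
    measurable_absv.coe_nnreal_ennreal.inv.mul hφ
  simp_rw [h1]
  rw [lintegral_const_mul (absv a : ℝ≥0∞) (f := fun x => (absv (a * x) : ℝ≥0∞)⁻¹ * φ (a * x))
    (hm.comp (measurable_const_mul a)), lintegral_comp_mul ha hm,
    ← mul_assoc, ENNReal.mul_inv_cancel ha0 ENNReal.coe_ne_top, one_mul]

theorem lintegral_haarUnits_mul_left (a : Kˣ) {φ : Kˣ → ℝ≥0∞} (hφ : Measurable φ) :
    ∫⁻ h, φ (a * h) ∂haarUnits K = ∫⁻ h, φ h ∂haarUnits K := by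
  obtain ⟨ψ, hψ, rfl⟩ := measurableEmbedding_unitsVal (K := K).exists_measurable_extend hφ
    fun _ => ⟨0⟩
  simp only [Function.comp_apply, Units.val_mul]
  rw [lintegral_haarUnits (φ := fun x => ψ (a * x)) (hψ.comp (measurable_const_mul (a : K))), lintegral_haarUnits hψ]
  exact lintegral_inv_absv_comp_mul a.ne_zero hψ

/-- The element `(x, h)` of the affine group. -/
def AffineGroup.mk (x : K) (h : Kˣ) : AffineGroup K := (x, h)

theorem AffineGroup.measurable_mk_left (h : Kˣ) : Measurable fun x : K => AffineGroup.mk x h :=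
  measurable_prodMk_right

theorem lintegral_haarAffine {Φ : AffineGroup K → ℝ≥0∞} (hΦ : Measurable Φ) :
    ∫⁻ r, Φ r ∂haarAffine K = ∫⁻ h : Kˣ, (absv (h : K) : ℝ≥0∞)⁻¹ *
      ∫⁻ x, Φ (AffineGroup.mk x h) ∂haarK K ∂haarUnits K := by
  have hw : Measurable fun r : K × Kˣ => (absv (r.2 : K) : ℝ≥0∞)⁻¹ :=
    (measurable_absv_unitsVal.comp measurable_snd).inv
  have hΦ' : Measurable (fun r : K × Kˣ => Φ r) := hΦ
  refine (lintegral_withDensity_eq_lintegral_mul ((haarK K).prod (haarUnits K)) hw hΦ').trans ?_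
  rw [lintegral_prod_symm _ (hw.mul hΦ').aemeasurable]
  refine lintegral_congr fun h => ?_
  exact lintegral_const_mul ((absv (h : K) : ℝ≥0∞)⁻¹)
    (hΦ.comp (AffineGroup.measurable_mk_left h))

theorem AffineGroup.mul_def (r s : AffineGroup K) :
    r * s = AffineGroup.mk ((r.2 : K) * s.1 + r.1) (r.2 * s.2) := rfl

theorem AffineGroup.continuous_mul_left (r : AffineGroup K) :
    Continuous fun s : AffineGroup K => r * s := by
  have : Continuous fun s : K × Kˣ => (((r.2 : K) * s.1 + r.1, r.2 * s.2) : K × Kˣ) := by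
    fun_prop
  exact this

instance : SecondCountableTopology (AffineGroup K) :=
  inferInstanceAs (SecondCountableTopology (K × Kˣ))

instance : BorelSpace (AffineGroup K) := inferInstanceAs (BorelSpace (K × Kˣ))

/-- The measure `haarAffine` is invariant under left translations. -/
theorem lintegral_haarAffine_mul_left (r : AffineGroup K) {Φ : AffineGroup K → ℝ≥0∞}
    (hΦ : Measurable Φ) :
    ∫⁻ s, Φ (r * s) ∂haarAffine K = ∫⁻ s, Φ s ∂haarAffine K := by
  rw [lintegral_haarAffine hΦ,
    lintegral_haarAffine (Φ := fun s => Φ (r * s)) (hΦ.comp (AffineGroup.continuous_mul_left r).measurable)]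
  have hψ : Measurable fun h : Kˣ => (absv (h : K) : ℝ≥0∞)⁻¹ *
      ∫⁻ x, Φ (AffineGroup.mk x h) ∂haarK K :=
    measurable_absv_unitsVal.inv.mul
      (Measurable.lintegral_prod_left' (f := fun r : K × Kˣ => Φ (AffineGroup.mk r.1 r.2)) hΦ)
  rw [← lintegral_haarUnits_mul_left r.2 hψ]
  refine lintegral_congr fun h => ?_
  have ha := (r.2⁻¹).ne_zero
  -- The map x ↦ r.2 x + r.1 is put in the form a⁻¹(x − b) with a = r.2⁻¹. Its scaling |r.2|⁻¹ turns
  -- the weight |h|⁻¹ into |r.2 h|⁻¹.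
  have hin : ∀ x : K, r * AffineGroup.mk x h = AffineGroup.mk
      (((r.2⁻¹ : Kˣ) : K)⁻¹ * (x - -((r.2⁻¹ : Kˣ) : K) * r.1)) (r.2 * h) := by
    intro x
    rw [AffineGroup.mul_def]
    change AffineGroup.mk ((r.2 : K) * x + r.1) (r.2 * h) = _
    congr 1
    have := r.2.ne_zero
    simp only [Units.val_inv_eq_inv_val]
    field_simp
    ring
  simp only [hin]
  rw [lintegral_comp_affine _ ha (φ := fun x => Φ (AffineGroup.mk x (r.2 * h)))
    (hΦ.comp (AffineGroup.measurable_mk_left _)),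
    Units.val_mul, absv_mul, ENNReal.coe_mul, ENNReal.mul_inv (Or.inl (coe_absv_units_ne_zero _))
    (Or.inl ENNReal.coe_ne_top), Units.val_inv_eq_inv_val, coe_absv_inv r.2.ne_zero]
  ring

theorem haarAffine_image_mul_left (r : AffineGroup K) {s : Set (AffineGroup K)}
    (hs : MeasurableSet s) :
    haarAffine K ((fun t => r * t) '' s) = haarAffine K s := by
  have h2 : (fun t => r * t) '' s = (fun t => r⁻¹ * t) ⁻¹' s := by
    ext t
    constructor
    · rintro ⟨u, hu, rfl⟩
      simpa using hu
    · intro ht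
      exact ⟨r⁻¹ * t, ht, by simp⟩
  have hm : MeasurableSet ((fun t => r⁻¹ * t) ⁻¹' s) :=
    (AffineGroup.continuous_mul_left r⁻¹).measurable hs
  have h := lintegral_haarAffine_mul_left r⁻¹ (Φ := s.indicator 1) (measurable_one.indicator hs)
  rw [lintegral_indicator_one hs] at h
  rw [h2, ← h, ← lintegral_indicator_one hm]
  rfl

/-- The integral of a function on the cosets of an open subgroup is a sum over
representatives. -/
theorem lintegral_haarAffine_eq_tsum {H : Subgroup (AffineGroup K)}
    (hH : IsOpen (H : Set (AffineGroup K))) {R : Set (AffineGroup K)}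
    (hR : Subgroup.IsComplement R (H : Set (AffineGroup K))) {Φ : AffineGroup K → ℝ≥0∞}
    (hΦ : ∀ r, ∀ h ∈ H, Φ (r * h) = Φ r) :
    Countable R ∧ ∫⁻ r, Φ r ∂haarAffine K = haarAffine K H * ∑' r : R, Φ r := by
  set C : AffineGroup K → Set (AffineGroup K) := fun r => (fun t => r * t) '' H with hC
  have hopen : ∀ r, IsOpen (C r) := fun r => by
    have : C r = (fun t => r⁻¹ * t) ⁻¹' H := by
      ext t
      constructor
      · rintro ⟨u, hu, rfl⟩
        simpa using hu
      · intro ht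
        exact ⟨r⁻¹ * t, ht, by simp⟩
    rw [this]
    exact hH.preimage (AffineGroup.continuous_mul_left _)
  rw [Subgroup.isComplement_iff_existsUnique] at hR
  have hdisj : R.PairwiseDisjoint C := by
    intro r hr s hs hrs
    refine Set.disjoint_left.mpr ?_
    rintro _ ⟨h, hh, rfl⟩ ⟨k, hk, hk2⟩
    have := (hR (r * h)).unique (y₁ := (⟨r, hr⟩, ⟨h, hh⟩)) (y₂ := (⟨s, hs⟩, ⟨k, hk⟩)) rfl hk2
    exact hrs (congrArg (fun p : R × (H : Set (AffineGroup K)) => (p.1 : AffineGroup K)) this)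
  -- Disjoint nonempty open cosets in a second countable space are countably many.
  have hcount : R.Countable := hdisj.countable_of_isOpen (fun r _ => hopen r)
    fun r _ => ⟨r * 1, 1, H.one_mem, rfl⟩
  have hunion : ⋃ r : R, C r = Set.univ := by
    refine Set.eq_univ_of_forall fun t => ?_
    obtain ⟨⟨r, h⟩, hrh, -⟩ := hR t
    exact Set.mem_iUnion.mpr ⟨r, h, h.2, hrh⟩
  have := hcount.to_subtype
  refine ⟨this, ?_⟩
  rw [← setLIntegral_univ, ← hunion, lintegral_iUnion (fun r : R => (hopen r).measurableSet)
    (fun r s hrs => hdisj r.2 s.2 fun h => hrs (Subtype.ext h)), ← ENNReal.tsum_mul_left]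
  congr 1
  ext r
  have : ∀ t ∈ C r, Φ t = Φ r := by
    rintro _ ⟨h, hh, rfl⟩
    exact hΦ _ _ hh
  rw [setLIntegral_congr_fun (hopen r).measurableSet this, setLIntegral_const,
    haarAffine_image_mul_left _ hH.measurableSet, mul_comm]

end Haar

/-! ### The norm identity for step functions, and their density in L² -/

section Wavelet

set_option linter.unusedSectionVars false

variable {K : Type*} [Field K] [ValuativeRel K] [TopologicalSpace K]
  [IsNonarchimedeanLocalField K] [MeasurableSpace K] [BorelSpace K]

local notation "𝓕[" χ "]" => Fourier.fourierIntegral χ (haarK _)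

theorem quasiMeasurePreserving_affine (x : K) (h : Kˣ) :
    Measure.QuasiMeasurePreserving (fun y : K => ((h⁻¹ : Kˣ) : K) * (y - x)) (haarK K)
      (haarK K) where
  measurable := by fun_prop
  absolutelyContinuous := by
    rw [smul_map_affine]
    exact Measure.smul_absolutelyContinuous

theorem quasiRegular_coeFn (r : AffineGroup K) (f : L2 K) :
    quasiRegular r f =ᵐ[haarK K] fun y => ((absv (r.2 : K) : ℝ) ^ (-(1 / 2) : ℝ)) •
      f (((r.2⁻¹ : Kˣ) : K) * (y - r.1)) :=
  MemLp.coeFn_toLp _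

theorem quasiRegular_toLp_coeFn (r : AffineGroup K) {g : K → ℂ} (hg : MemLp g 2 (haarK K)) :
    quasiRegular r (hg.toLp g) =ᵐ[haarK K] fun y => ((absv (r.2 : K) : ℝ) ^ (-(1 / 2) : ℝ)) •
      g (((r.2⁻¹ : Kˣ) : K) * (y - r.1)) := by
  filter_upwards [quasiRegular_coeFn r (hg.toLp g),
    (quasiMeasurePreserving_affine r.1 r.2).ae hg.coeFn_toLp] with y h1 h2
  rw [h1, h2]

theorem quasiRegular_mul (r s : AffineGroup K) (f : L2 K) :
    quasiRegular (r * s) f = quasiRegular r (quasiRegular s f) := by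
  refine Lp.ext ?_
  filter_upwards [quasiRegular_coeFn (r * s) f, quasiRegular_coeFn r (quasiRegular s f),
    (quasiMeasurePreserving_affine r.1 r.2).ae (quasiRegular_coeFn s f)] with y h1 h2 h3
  rw [h1, h2, h3, smul_smul]
  have h4 : (r * s).2 = r.2 * s.2 := rfl
  have h5 : (r * s).1 = (r.2 : K) * s.1 + r.1 := rfl
  rw [h4, h5]
  congr 1
  · rw [Units.val_mul, absv_mul, NNReal.coe_mul, Real.mul_rpow (by positivity) (by positivity)]
  · congr 1
    have := r.2.ne_zero
    have := s.2.ne_zero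
    simp only [Units.val_inv_eq_inv_val, Units.val_mul]
    field_simp
    ring

/-- The wavelet transform is a correlation. -/
theorem waveletTransform_toLp {f g : K → ℂ} (hf : MemLp f 2 (haarK K))
    (hg : MemLp g 2 (haarK K)) (x : K) (h : Kˣ) :
    waveletTransform (hg.toLp g) (hf.toLp f) (AffineGroup.mk x h)
      = ((absv (h : K) : ℝ) ^ (-(1 / 2) : ℝ) : ℝ)
        * correlation f (fun y => g ((h : K)⁻¹ * y)) x := by
  rw [waveletTransform, L2.inner_def, correlation, ← integral_const_mul]
  refine integral_congr_ae ?_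
  filter_upwards [quasiRegular_toLp_coeFn (AffineGroup.mk x h) hg, hf.coeFn_toLp] with y h1 h2
  rw [h1, h2]
  simp only [AffineGroup.mk, RCLike.inner_apply, Complex.real_smul, map_mul, Complex.conj_ofReal,
    Units.val_inv_eq_inv_val]
  ring

theorem enorm_sq_waveletTransform_toLp {f g : K → ℂ} (hf : MemLp f 2 (haarK K))
    (hg : MemLp g 2 (haarK K)) (x : K) (h : Kˣ) :
    ‖waveletTransform (hg.toLp g) (hf.toLp f) (AffineGroup.mk x h)‖ₑ ^ 2
      = (absv (h : K) : ℝ≥0∞)⁻¹ * ‖correlation f (fun y => g ((h : K)⁻¹ * y)) x‖ₑ ^ 2 := by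
  rw [waveletTransform_toLp, enorm_mul, mul_pow]
  congr 1
  have hpos : 0 < (absv (h : K) : ℝ) := absv_units_pos h
  rw [← ofReal_norm, Complex.norm_real, Real.norm_of_nonneg (by positivity),
    ← ENNReal.ofReal_pow (by positivity), ← Real.rpow_natCast, ← Real.rpow_mul hpos.le]
  norm_num
  rw [Real.rpow_neg_one, ENNReal.ofReal_inv_of_pos hpos, ENNReal.ofReal_coe_nnreal]

theorem IsStep.comp_mul {g : K → ℂ} {c d : K} (hg : IsStep g c d) {a : K} (ha : a ≠ 0) :
    IsStep (fun y => g (a⁻¹ * y)) (a * c) (a * d) where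
  map_add u hu x := by
    rw [mul_add]
    refine hg.map_add _ ?_ _
    rw [← mul_mem_ball_mul ha, mul_inv_cancel_left₀ ha]
    exact hu
  eq_zero x hx := by
    refine hg.eq_zero _ fun h => hx ?_
    rwa [← mul_mem_ball_mul ha, mul_inv_cancel_left₀ ha] at h

theorem fourierIntegral_comp_mul {χ : AddChar K Circle} (hχ : Continuous χ) {g : K → ℂ}
    (hg : Continuous g) {a : K} (ha : a ≠ 0) (ξ : K) :
    𝓕[χ] (fun y => g (a⁻¹ * y)) ξ = (absv a : ℝ) • 𝓕[χ] g (a * ξ) := by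
  have hcont : Continuous fun v => χ (-(v * (a * ξ))) • g v := by fun_prop
  have hT : Measurable fun y : K => a⁻¹ * (y - 0) := by fun_prop
  have h := integral_map (μ := haarK K) hT.aemeasurable
    (f := fun v => χ (-(v * (a * ξ))) • g v) hcont.aestronglyMeasurable
  rw [map_affine_eq 0 ha, integral_smul_nnreal_measure] at h
  rw [Fourier.fourierIntegral_def, Fourier.fourierIntegral_def]
  refine Eq.trans (integral_congr_ae (Filter.Eventually.of_forall fun v => ?_)) h.symm
  have : v * ξ = a⁻¹ * v * (a * ξ) := by field_simp
  simp only [sub_zero, this]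

/-- The admissibility constant as an element of `[0, ∞]`. -/
noncomputable def eAdmissibilityConst (χ : AddChar K Circle) (g : K → ℂ) : ℝ≥0∞ :=
  ∫⁻ ξ, (absv ξ : ℝ≥0∞)⁻¹ * ‖𝓕[χ] g ξ‖ₑ ^ 2 ∂haarK K

theorem eAdmissibilityConst_eq_ofReal {χ : AddChar K Circle} (hχ : IsStandardCharacter χ)
    {g : K → ℂ} (hg : IsS0 g) :
    eAdmissibilityConst χ g = ENNReal.ofReal (admissibilityConst χ g) := by
  rw [admissibilityConst, ofReal_integral_eq_lintegral_ofReal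
    (integrable_admissibilityDensity hχ hg)
    (Filter.Eventually.of_forall fun x => by simp only [admissibilityDensity]; positivity)]
  refine lintegral_congr_ae ?_
  filter_upwards [ae_ne_zero] with ξ hξ
  have hpos : 0 < (absv ξ : ℝ) := absv_pos hξ
  rw [admissibilityDensity, ENNReal.ofReal_div_of_pos hpos, ENNReal.ofReal_pow (norm_nonneg _),
    ofReal_norm, ENNReal.ofReal_coe_nnreal, div_eq_mul_inv, mul_comm]

/-- The wavelet transform multiplies the norm of a locally constant function of compact support
by a constant. -/
theorem lintegral_enorm_sq_waveletTransform_of_isStep {χ : AddChar K Circle}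
    (hχ : IsStandardCharacter χ) {f g : K → ℂ} {c d c' d' : K} (hf : IsStep f c d)
    (hg : IsStep g c' d') (hc : c ≠ 0) (hd : d ≠ 0) (hc' : c' ≠ 0) (hd' : d' ≠ 0)
    (hfL : MemLp f 2 (haarK K)) (hgL : MemLp g 2 (haarK K))
    (hm : Measurable (waveletTransform (hgL.toLp g) (hfL.toLp f))) :
    ∫⁻ r, ‖waveletTransform (hgL.toLp g) (hfL.toLp f) r‖ₑ ^ 2 ∂haarAffine K
      = eAdmissibilityConst χ g * ∫⁻ x, ‖f x‖ₑ ^ 2 ∂haarK K := by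
  have hF : Measurable fun ξ => ‖𝓕[χ] f ξ‖ₑ ^ 2 :=
    ((hf.fourierIntegral hχ hc hd).continuous (inv_ne_zero hd)).enorm.measurable.pow_const 2
  have hG : Measurable fun ξ => ‖𝓕[χ] g ξ‖ₑ ^ 2 :=
    ((hg.fourierIntegral hχ hc' hd').continuous (inv_ne_zero hd')).enorm.measurable.pow_const 2
  rw [lintegral_haarAffine (hm.enorm.pow_const 2)]
  have h1 : ∀ h : Kˣ, (absv (h : K) : ℝ≥0∞)⁻¹ * ∫⁻ x, ‖waveletTransform (hgL.toLp g)
      (hfL.toLp f) (AffineGroup.mk x h)‖ₑ ^ 2 ∂haarK K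
      = ∫⁻ ξ, ‖𝓕[χ] f ξ‖ₑ ^ 2 * ‖𝓕[χ] g (h * ξ)‖ₑ ^ 2 ∂haarK K := by
    intro h
    have h0 : (h : K) ≠ 0 := h.ne_zero
    have hs := hg.comp_mul h0
    have hcor := (lintegral_enorm_sq_correlation hχ hf hs hc hd (mul_ne_zero h0 hc')
      (mul_ne_zero h0 hd'))
    have hne := coe_absv_units_ne_zero h
    have hinv : ((absv (h : K) : ℝ≥0∞))⁻¹ ≠ ∞ := ENNReal.inv_ne_top.mpr hne
    simp_rw [enorm_sq_waveletTransform_toLp]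
    rw [lintegral_const_mul' _ _ hinv, hcor, ← lintegral_const_mul' _ _ hinv,
      ← lintegral_const_mul' _ _ hinv]
    refine lintegral_congr fun ξ => ?_
    rw [fourierIntegral_comp_mul hχ.1 (hg.continuous hc') h0, enorm_smul, mul_pow]
    have he : ‖(absv (h : K) : ℝ)‖ₑ = (absv (h : K) : ℝ≥0∞) := by
      rw [Real.enorm_eq_ofReal (by positivity), ENNReal.ofReal_coe_nnreal]
    rw [he]
    -- One |h|⁻¹ comes from the Haar measure of G, one from the normalization of π, and |h|² from
    -- the transform of the dilate.
    calc _ = ((absv (h : K) : ℝ≥0∞)⁻¹ * (absv (h : K) : ℝ≥0∞)) ^ 2 *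
          (‖𝓕[χ] f ξ‖ₑ ^ 2 * ‖𝓕[χ] g (h * ξ)‖ₑ ^ 2) := by ring
      _ = _ := by rw [ENNReal.inv_mul_cancel hne ENNReal.coe_ne_top, one_pow, one_mul]
  simp_rw [h1]
  rw [lintegral_lintegral_swap, ← lintegral_enorm_sq_fourierIntegral hχ hf hc hd,
    ← lintegral_const_mul _ hF]
  · refine lintegral_congr_ae ?_
    filter_upwards [ae_ne_zero] with ξ hξ
    have hGξ : Measurable fun t => ‖𝓕[χ] g (ξ * t)‖ₑ ^ 2 := hG.comp (measurable_const_mul ξ)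
    simp_rw [mul_comm _ ξ]
    rw [lintegral_const_mul _ (show Measurable fun h : Kˣ => ‖𝓕[χ] g (ξ * h)‖ₑ ^ 2 from
      hGξ.comp measurable_unitsVal), mul_comm]
    congr 1
    -- For ξ ≠ 0, invariance of dt/|t| removes ξ and leaves the admissibility constant.
    rw [lintegral_haarUnits hGξ]
    exact lintegral_inv_absv_comp_mul hξ hG
  · have h2 : Measurable fun p : Kˣ × K => ‖𝓕[χ] f p.2‖ₑ ^ 2 * ‖𝓕[χ] g (p.1 * p.2)‖ₑ ^ 2 :=
      (hF.comp measurable_snd).mul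
        (hG.comp ((measurable_unitsVal.comp measurable_fst).mul measurable_snd))
    exact h2.aemeasurable

/-- Locally constant functions of compact support are dense in `L²(K)`. -/
theorem exists_isStep_norm_sub_lt (F : L2 K) {ε : ℝ} (hε : 0 < ε) :
    ∃ (f : K → ℂ) (c d : K) (_ : c ≠ 0) (_ : d ≠ 0) (_ : IsStep f c d)
      (hf : MemLp f 2 (haarK K)), ‖F - hf.toLp f‖ < ε := by
  have hε2 : ENNReal.ofReal (ε / 2) ≠ 0 := by simpa using hε
  obtain ⟨g, hgc, hFg, hg, hgL⟩ := (Lp.memLp F).exists_hasCompactSupport_eLpNorm_sub_le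
    ENNReal.ofNat_ne_top hε2
  obtain ⟨d, hd, hsub⟩ := exists_subset_ball hgc
  have hz : ∀ x, x ∉ ball d → g x = 0 := fun x hx =>
    image_eq_zero_of_notMem_tsupport fun h => hx (hsub h)
  -- A uniform error δ on d𝒪 costs δ |d𝒪|^(1/2) in L², here less than ε/2.
  obtain ⟨δ, hδ, hδM⟩ := ENNReal.exists_nnreal_pos_mul_lt
    (a := haarK K (ball d) ^ (1 / (2 : ℝ≥0∞).toReal))
    (ENNReal.rpow_ne_top_of_nonneg (by positivity) (haarK_ball_lt_top d).ne) hε2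
  have key : ∀ᶠ u in nhds (0 : K), ∀ x ∈ (ball d : Set K), dist (g (x + u)) (g x) < δ := by
    refine (isCompact_ball d).eventually_forall_of_forall_eventually fun y _ => ?_
    have hcont : Continuous fun z : K × K => dist (g (z.2 + z.1)) (g z.2) := by fun_prop
    refine (hcont.tendsto (0, y)).eventually (gt_mem_nhds ?_)
    simpa using hδ
  -- Requiring also c𝒪 ⊆ d𝒪 keeps the cutoff to d𝒪 invariant under c𝒪. The step function samples g
  -- at one representative p x of each coset of c𝒪.
  obtain ⟨c, hc, hcs⟩ := exists_ball_subset (Filter.inter_mem key (ball_mem_nhds hd))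
  let p : K → K := fun x => (QuotientAddGroup.mk x : K ⧸ ball c).out
  have hp : ∀ x, -x + p x ∈ ball c := fun x => by
    rw [← QuotientAddGroup.eq, QuotientAddGroup.out_eq']
  have hpu : ∀ u ∈ ball c, ∀ x, p (x + u) = p x := fun u hu x => by
    have : (QuotientAddGroup.mk (x + u) : K ⧸ ball c) = QuotientAddGroup.mk x := by
      rw [eq_comm, QuotientAddGroup.eq]
      simpa using hu
    simp only [p, this]
  set f : K → ℂ := (ball d : Set K).indicator fun x => g (p x) with hfdef
  have hf : IsStep f c d := by
    refine ⟨fun u hu x => ?_, fun x hx => Set.indicator_of_notMem hx _⟩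
    have hud : u ∈ ball d := (hcs hu).2
    by_cases hx : x ∈ ball d
    · rw [hfdef, Set.indicator_of_mem (show x ∈ (ball d : Set K) from hx),
        Set.indicator_of_mem (show x + u ∈ (ball d : Set K) from (ball d).add_mem hx hud),
        hpu u hu]
    · rw [hfdef, Set.indicator_of_notMem (show x ∉ (ball d : Set K) from hx),
        Set.indicator_of_notMem (show x + u ∉ (ball d : Set K) from
          fun h => hx ((add_mem_cancel_right hud).mp h))]
  have hfL : MemLp f 2 (haarK K) :=
    (hf.continuous hc).memLp_of_hasCompactSupport hf.hasCompactSupport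
  refine ⟨f, c, d, hc, hd, hf, hfL, ?_⟩
  have hgf : eLpNorm (g - f) 2 (haarK K) < ENNReal.ofReal (ε / 2) := by
    refine lt_of_le_of_lt ?_ hδM
    have h1 : eLpNorm (g - f) 2 (haarK K)
        ≤ eLpNorm ((ball d : Set K).indicator fun _ => (δ : ℝ)) 2 (haarK K) := by
      refine eLpNorm_mono fun x => ?_
      by_cases hx : x ∈ ball d
      · rw [Set.indicator_of_mem (show x ∈ (ball d : Set K) from hx), Pi.sub_apply, hfdef,
          Set.indicator_of_mem (show x ∈ (ball d : Set K) from hx)]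
        have := (hcs (hp x)).1 x hx
        rw [add_neg_cancel_left, dist_comm, dist_eq_norm] at this
        simpa using this.le
      · simp [hz x hx, hf.eq_zero x hx]
    refine h1.trans ?_
    rw [eLpNorm_indicator_const (isOpen_ball hd).measurableSet two_ne_zero ENNReal.ofNat_ne_top,
      Real.enorm_eq_ofReal δ.coe_nonneg, ENNReal.ofReal_coe_nnreal]
  have h2 : eLpNorm (F - f : K → ℂ) 2 (haarK K) < ENNReal.ofReal ε := by
    have : (F - f : K → ℂ) = (F - g) + (g - f) := by abel
    rw [this]
    refine lt_of_le_of_lt (eLpNorm_add_le ((Lp.aestronglyMeasurable F).sub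
      hgL.aestronglyMeasurable) (hgL.aestronglyMeasurable.sub hfL.aestronglyMeasurable)
      (by norm_num)) ?_
    refine lt_of_lt_of_eq (ENNReal.add_lt_add_of_le_of_lt (ne_top_of_le_ne_top
      ENNReal.ofReal_ne_top hFg) hFg hgf) ?_
    rw [← ENNReal.ofReal_add (by positivity) (by positivity), add_halves]
  rw [Lp.norm_def]
  refine ENNReal.toReal_lt_of_lt_ofReal ?_
  rwa [eLpNorm_congr_ae ((Lp.coeFn_sub F (hfL.toLp f)).trans
    (Filter.EventuallyEq.rfl.sub hfL.coeFn_toLp))]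

end Wavelet

/-! ### Hilbert space: extension from a dense set, and tight frame expansions -/

section Frame

theorem eLpNorm_two_sq {X F : Type*} [MeasurableSpace X] [NormedAddCommGroup F] (μ : Measure X)
    (f : X → F) : eLpNorm f 2 μ ^ 2 = ∫⁻ x, ‖f x‖ₑ ^ 2 ∂μ := by
  have := eLpNorm_nnreal_pow_eq_lintegral (f := f) (μ := μ) (p := 2) two_ne_zero
  simpa using this

variable {E : Type*} [NormedAddCommGroup E] [InnerProductSpace ℂ E]

open Filter Topology in
/-- If the analysis operator of a family is a multiple of an isometry on a dense set, it is so
everywhere. -/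
theorem eLpNorm_inner_eq_of_dense {X : Type*} [MeasurableSpace X] {μ : Measure X} {v : X → E}
    (hm : ∀ f, Measurable fun r => inner ℂ (v r) f) {c : ℝ≥0∞} (hc : c ≠ ∞) {D : Set E}
    (hD : Dense D) (h : ∀ f ∈ D, eLpNorm (fun r => inner ℂ (v r) f) 2 μ = c * ‖f‖ₑ) (f : E) :
    eLpNorm (fun r => inner ℂ (v r) f) 2 μ = c * ‖f‖ₑ := by
  have hle : ∀ f, eLpNorm (fun r => inner ℂ (v r) f) 2 μ ≤ c * ‖f‖ₑ := by
    intro f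
    obtain ⟨u, hu, hlim⟩ := mem_closure_iff_seq_limit.mp (hD f)
    have h1 : Tendsto (fun n => c * ‖u n‖ₑ) atTop (𝓝 (c * ‖f‖ₑ)) :=
      ENNReal.Tendsto.const_mul hlim.enorm (Or.inr hc)
    -- Fatou's lemma applies since the inner products converge pointwise along u.
    refine (Lp.eLpNorm_lim_le_liminf_eLpNorm (f := fun n r => inner ℂ (v r) (u n))
      (fun n => (hm _).aestronglyMeasurable) _
      (Eventually.of_forall fun r => tendsto_const_nhds.inner hlim)).trans ?_
    simp_rw [fun n => h _ (hu n)]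
    rw [h1.liminf_eq]
  refine le_antisymm (hle f) ?_
  obtain ⟨u, hu, hlim⟩ := mem_closure_iff_seq_limit.mp (hD f)
  have h1 : Tendsto (fun n => c * ‖u n‖ₑ) atTop (𝓝 (c * ‖f‖ₑ)) :=
    ENNReal.Tendsto.const_mul hlim.enorm (Or.inr hc)
  have h2 : Tendsto (fun n => eLpNorm (fun r => inner ℂ (v r) f) 2 μ + c * ‖u n - f‖ₑ) atTop
      (𝓝 (eLpNorm (fun r => inner ℂ (v r) f) 2 μ + c * ‖f - f‖ₑ)) :=
    tendsto_const_nhds.add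
      (ENNReal.Tendsto.const_mul (hlim.sub tendsto_const_nhds).enorm (Or.inr hc))
  rw [sub_self, enorm_zero, mul_zero, add_zero] at h2
  -- For the reverse bound, the triangle inequality compares f with u n, and the upper bound
  -- controls their difference.
  refine le_of_tendsto_of_tendsto' h1 h2 fun n => ?_
  rw [← h _ (hu n)]
  have h3 : (fun r => inner ℂ (v r) (u n))
      = (fun r => inner ℂ (v r) f) + fun r => inner ℂ (v r) (u n - f) := by
    ext r
    rw [Pi.add_apply, ← inner_add_right, add_sub_cancel]
  rw [h3]
  exact (eLpNorm_add_le (hm _).aestronglyMeasurable (hm _).aestronglyMeasurable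
    (by norm_num)).trans (by gcongr; exact hle _)

/-- The expansion with respect to a tight frame. -/
theorem IsTightFrame.hasSum [CompleteSpace E] {ι : Type*} {v : ι → E} {A : ℝ}
    (h : IsTightFrame v A) (f : E) :
    HasSum (fun i => ((A⁻¹ : ℝ) : ℂ) • (inner ℂ (v i) f • v i)) f := by
  classical
  obtain ⟨hA, hsum⟩ := h
  set s : ℝ := (√A)⁻¹ with hs
  have hs2 : s ^ 2 = A⁻¹ := by rw [hs, inv_pow, Real.sq_sqrt hA.le]
  have hS : ∀ f, HasSum (fun i => ‖(s : ℂ) * inner ℂ (v i) f‖ ^ 2) (‖f‖ ^ 2) := by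
    intro f
    have := (hsum f).mul_left (s ^ 2)
    rw [← mul_assoc, hs2, inv_mul_cancel₀ hA.ne', one_mul, ← hs2] at this
    simpa [mul_pow] using this
  have hmem : ∀ f, Memℓp (fun i => (s : ℂ) * inner ℂ (v i) f) 2 := fun f =>
    memℓp_gen (by simpa using (hS f).summable)
  -- Scaled by A^(-1/2), the analysis operator is an isometry into ℓ², so U*U = 1. Applying U*,
  -- which sends the i-th unit vector to s • v i, to the coordinate expansion of U f gives the
  -- series.
  let U : E →ₗᵢ[ℂ] lp (fun _ : ι => ℂ) 2 :=
    { toFun := fun f => ⟨fun i => (s : ℂ) * inner ℂ (v i) f, hmem f⟩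
      map_add' := fun f g => by
        ext i
        exact (congrArg (_ * ·) (inner_add_right _ _ _)).trans (mul_add _ _ _)
      map_smul' := fun a f => by
        ext i
        exact (congrArg (_ * ·) (inner_smul_right _ _ _)).trans (mul_left_comm _ _ _)
      norm_map' := fun f => by
        refine (sq_eq_sq₀ (norm_nonneg _) (norm_nonneg _)).mp ?_
        have := lp.norm_rpow_eq_tsum (p := 2) (by norm_num)
          (⟨fun i => (s : ℂ) * inner ℂ (v i) f, hmem f⟩ : lp (fun _ : ι => ℂ) 2)
        rw [← (hS f).tsum_eq]
        simpa using this }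
  have hUapp : ∀ f i, (U f : ι → ℂ) i = (s : ℂ) * inner ℂ (v i) f := fun f i => rfl
  have hadj : ContinuousLinearMap.adjoint U.toContinuousLinearMap (U f) = f := by
    refine ext_inner_right ℂ fun y => ?_
    rw [ContinuousLinearMap.adjoint_inner_left]
    exact U.inner_map_map f y
  have hsingle : ∀ i a, ContinuousLinearMap.adjoint U.toContinuousLinearMap (lp.single 2 i a)
      = ((s : ℂ) * a) • v i := by
    intro i a
    refine ext_inner_right ℂ fun y => ?_
    rw [ContinuousLinearMap.adjoint_inner_left, lp.inner_single_left, inner_smul_left]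
    change inner ℂ a ((U y : ι → ℂ) i) = _
    rw [hUapp, RCLike.inner_apply]
    simp
    ring
  have hU := (lp.hasSum_single (by norm_num) (U f)).mapL
    (ContinuousLinearMap.adjoint U.toContinuousLinearMap)
  rw [hadj] at hU
  convert hU using 1
  ext i
  rw [hsingle, hUapp, smul_smul, ← mul_assoc, ← hs2]
  push_cast
  ring_nf

end Frame

/-! ### The norm identity on L² and the passage to cosets -/

section Main

set_option linter.unusedSectionVars false

variable {K : Type*} [Field K] [ValuativeRel K] [TopologicalSpace K]
  [IsNonarchimedeanLocalField K] [MeasurableSpace K] [BorelSpace K]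

theorem waveletTransform_mul_of_mem {H : Subgroup (AffineGroup K)} {g : L2 K}
    (hfix : ∀ r ∈ H, quasiRegular r g = g) (f : L2 K) (r : AffineGroup K) {h : AffineGroup K}
    (hh : h ∈ H) : waveletTransform g f (r * h) = waveletTransform g f r := by
  rw [waveletTransform, quasiRegular_mul, hfix h hh, waveletTransform]

/-- Invariance under right translation by the open subgroup H makes the transform locally constant.
-/
theorem measurable_waveletTransform {H : Subgroup (AffineGroup K)}
    (hH : IsOpen (H : Set (AffineGroup K))) {g : L2 K} (hfix : ∀ r ∈ H, quasiRegular r g = g)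
    (f : L2 K) : Measurable (waveletTransform g f) := by
  refine IsLocallyConstant.continuous ?_ |>.measurable
  refine (IsLocallyConstant.iff_eventually_eq _).mpr fun r => ?_
  have h1 : ((fun t => r⁻¹ * t) ⁻¹' (H : Set (AffineGroup K))) ∈ nhds r :=
    (hH.preimage (AffineGroup.continuous_mul_left r⁻¹)).mem_nhds (by simp)
  filter_upwards [h1] with t ht
  have := waveletTransform_mul_of_mem hfix f r ht
  rwa [mul_inv_cancel_left] at this

/-- The weight |ξ|⁻¹ is nowhere zero in [0, ∞], so a zero constant forces the transform, and by
Plancherel and continuity g itself, to vanish. -/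
theorem eAdmissibilityConst_ne_zero {χ : AddChar K Circle} (hχ : IsStandardCharacter χ)
    {g : K → ℂ} (hg : IsS0 g) (hg0 : g ≠ 0) : eAdmissibilityConst χ g ≠ 0 := by
  obtain ⟨c, d, hc, hd, hs⟩ := exists_isStep hg.isLocallyConstant hg.hasCompactSupport
  have hF := (hs.fourierIntegral hχ hc hd).continuous (inv_ne_zero hd)
  intro h
  have hm : Measurable fun ξ : K =>
      (absv ξ : ℝ≥0∞)⁻¹ * ‖Fourier.fourierIntegral χ (haarK K) g ξ‖ₑ ^ 2 :=
    measurable_absv.coe_nnreal_ennreal.inv.mul (hF.enorm.measurable.pow_const 2)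
  rw [eAdmissibilityConst, lintegral_eq_zero_iff hm] at h
  have h1 : ∫⁻ x, ‖g x‖ₑ ^ 2 ∂haarK K = 0 := by
    rw [← lintegral_enorm_sq_fourierIntegral hχ hs hc hd,
      lintegral_eq_zero_iff (hF.enorm.measurable.pow_const 2)]
    filter_upwards [h] with ξ hξ
    exact (mul_eq_zero.mp hξ).resolve_left (ENNReal.inv_ne_zero.mpr ENNReal.coe_ne_top)
  have hgc := hs.continuous hc
  rw [lintegral_eq_zero_iff (hgc.enorm.measurable.pow_const 2)] at h1
  refine hg0 ((hgc.ae_eq_iff_eq (haarK K) continuous_zero).mp ?_)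
  filter_upwards [h1] with x hx
  simpa using hx

/-- The wavelet transform multiplies the norm of `L²(K)` by a constant. -/
theorem lintegral_enorm_sq_waveletTransform {χ : AddChar K Circle}
    (hχ : IsStandardCharacter χ) {g : K → ℂ} (hg : IsS0 g)
    {H : Subgroup (AffineGroup K)} (hH : IsOpen (H : Set (AffineGroup K)))
    (hfix : ∀ r ∈ H, quasiRegular r hg.toL2 = hg.toL2) (f : L2 K) :
    ∫⁻ r, ‖waveletTransform hg.toL2 f r‖ₑ ^ 2 ∂haarAffine K
      = eAdmissibilityConst χ g * ‖f‖ₑ ^ 2 := by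
  obtain ⟨c', d', hc', hd', hgs⟩ := exists_isStep hg.isLocallyConstant hg.hasCompactSupport
  have hC : eAdmissibilityConst χ g ≠ ∞ := by
    rw [eAdmissibilityConst_eq_ofReal hχ hg]; exact ENNReal.ofReal_ne_top
  set D : Set (L2 K) := {F | ∃ (f : K → ℂ) (c d : K) (_ : c ≠ 0) (_ : d ≠ 0) (_ : IsStep f c d)
    (hf : MemLp f 2 (haarK K)), F = hf.toLp f} with hD
  have hdense : Dense D := by
    refine Metric.dense_iff.mpr fun F ε hε => ?_
    obtain ⟨f, c, d, hc, hd, hs, hf, hlt⟩ := exists_isStep_norm_sub_lt F hε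
    refine ⟨hf.toLp f, ?_, f, c, d, hc, hd, hs, hf, rfl⟩
    rwa [Metric.mem_ball, dist_comm, dist_eq_norm]
  set s : ℝ≥0∞ := eAdmissibilityConst χ g ^ (1 / 2 : ℝ) with hs
  have hs2 : s ^ 2 = eAdmissibilityConst χ g := by
    rw [hs, ← ENNReal.rpow_natCast, ← ENNReal.rpow_mul]
    norm_num
  have key := eLpNorm_inner_eq_of_dense (μ := haarAffine K)
    (v := fun r => quasiRegular r hg.toL2) (measurable_waveletTransform hH hfix) (c := s)
    (ENNReal.rpow_ne_top_of_nonneg (by norm_num) hC) hdense (by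
      rintro _ ⟨f, c, d, hc, hd, hst, hf, rfl⟩
      refine (ENNReal.pow_right_strictMono two_ne_zero).injective ?_
      rw [eLpNorm_two_sq, mul_pow, hs2, Lp.enorm_toLp, eLpNorm_two_sq]
      exact lintegral_enorm_sq_waveletTransform_of_isStep hχ hst hgs hc hd hc' hd' hf hg.memLp
        (measurable_waveletTransform hH hfix _)) f
  have := congrArg (· ^ 2) key
  simp only [eLpNorm_two_sq, mul_pow, hs2] at this
  exact this

end Main

end LocalFieldWavelet

open LocalFieldWavelet in
theorem theorem6p1 {K : Type*} [Field K] [ValuativeRel K] [TopologicalSpace K]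
    [IsNonarchimedeanLocalField K] [MeasurableSpace K] [BorelSpace K]
    (χ : AddChar K Circle) (hχ : IsStandardCharacter χ)
    (g : K → ℂ) (hg : IsS0 g) (hg0 : g ≠ 0)
    (H : Subgroup (AffineGroup K)) (hHopen : IsOpen (H : Set (AffineGroup K)))
    (hHcompact : IsCompact (H : Set (AffineGroup K)))
    (hfix : ∀ r ∈ H, quasiRegular r hg.toL2 = hg.toL2)
    (R : Set (AffineGroup K)) (hR : Subgroup.IsComplement R (H : Set (AffineGroup K))) :
    -- the admissibility constant is finite and is the constant of the wavelet transform
    (MeasureTheory.Integrable (admissibilityDensity χ g) (haarK K) ∧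
      ∀ f : L2 K, ∫ r, ‖waveletTransform hg.toL2 f r‖ ^ 2 ∂haarAffine K
        = admissibilityConst χ g * ‖f‖ ^ 2) ∧
    -- tight frame
    IsTightFrame (fun r : R => quasiRegular (r : AffineGroup K) hg.toL2)
      (admissibilityConst χ g / (haarAffine K).real (H : Set (AffineGroup K))) ∧
    -- wavelet expansion, unconditionally convergent in `L²`
    ∀ f : L2 K,
      HasSum (fun r : R => (((haarAffine K).real (H : Set (AffineGroup K))
          / admissibilityConst χ g : ℝ) : ℂ) •
          (waveletTransform hg.toL2 f r • quasiRegular (r : AffineGroup K) hg.toL2)) f := by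
  have hconst := eAdmissibilityConst_eq_ofReal hχ hg
  have hC0 := eAdmissibilityConst_ne_zero hχ hg hg0
  have hCpos : 0 < admissibilityConst χ g := by
    rw [hconst] at hC0
    simpa using hC0
  have hN : ∀ f : L2 K, ∫⁻ r, ‖waveletTransform hg.toL2 f r‖ₑ ^ 2 ∂haarAffine K
      = ENNReal.ofReal (admissibilityConst χ g * ‖f‖ ^ 2) := by
    intro f
    rw [lintegral_enorm_sq_waveletTransform hχ hg hHopen hfix, hconst,
      ENNReal.ofReal_mul hCpos.le, ENNReal.ofReal_pow (norm_nonneg _), ofReal_norm]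
  have hsum := fun f : L2 K => (lintegral_haarAffine_eq_tsum hHopen hR
    (Φ := fun r => ‖waveletTransform hg.toL2 f r‖ₑ ^ 2) fun r h hh => by
      rw [waveletTransform_mul_of_mem hfix f r hh]).2
  have hG0 : hg.toL2 ≠ 0 := by
    intro h
    refine hg0 ((hg.isLocallyConstant.continuous.ae_eq_iff_eq (haarK K) continuous_zero).mp ?_)
    filter_upwards [hg.memLp.coeFn_toLp, Lp.coeFn_zero ℂ 2 (haarK K)] with x h1 h2
    have h3 : hg.memLp.toLp g = 0 := h
    rw [← h1, h3, h2]
  -- Taking f = g makes the product of μ(H) with the sum finite and nonzero, which forces 0 < μ(H) <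
  -- ∞.
  have hprod : haarAffine K H * ∑' r : R, ‖waveletTransform hg.toL2 hg.toL2 r‖ₑ ^ 2
      = ENNReal.ofReal (admissibilityConst χ g * ‖hg.toL2‖ ^ 2) :=
    (hsum _).symm.trans (hN _)
  have hne : ENNReal.ofReal (admissibilityConst χ g * ‖hg.toL2‖ ^ 2) ≠ 0 := by
    have := norm_pos_iff.mpr hG0
    simpa using by positivity
  have hH0 : haarAffine K H ≠ 0 := fun h => hne (by rw [← hprod, h, zero_mul])
  have hHtop : haarAffine K H ≠ ∞ := by
    intro h
    rw [h, ENNReal.top_mul fun h0 => hne (by rw [← hprod, h0, mul_zero])] at hprod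
    exact ENNReal.ofReal_ne_top hprod.symm
  have hHpos : 0 < (haarAffine K).real (H : Set (AffineGroup K)) :=
    ENNReal.toReal_pos hH0 hHtop
  have hframe : IsTightFrame (fun r : R => quasiRegular (r : AffineGroup K) hg.toL2)
      (admissibilityConst χ g / (haarAffine K).real (H : Set (AffineGroup K))) := by
    refine ⟨div_pos hCpos hHpos, fun f => ?_⟩
    have h1 : ∑' r : R, ‖waveletTransform hg.toL2 f r‖ₑ ^ 2
        = ENNReal.ofReal (admissibilityConst χ g * ‖f‖ ^ 2) / haarAffine K H := by
      rw [← hN, hsum, mul_comm, ENNReal.mul_div_cancel_right hH0 hHtop]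
    have htop : ∑' r : R, ‖waveletTransform hg.toL2 f r‖ₑ ^ 2 ≠ ∞ := by
      rw [h1]
      exact ENNReal.div_ne_top ENNReal.ofReal_ne_top hH0
    have h2 := ENNReal.hasSum_toReal htop
    rw [← ENNReal.tsum_toReal_eq (fun r => ENNReal.ne_top_of_tsum_ne_top htop r), h1,
      ENNReal.toReal_div, ENNReal.toReal_ofReal (by positivity), ← measureReal_def,
      mul_div_right_comm] at h2
    simpa [waveletTransform] using h2
  refine ⟨⟨integrable_admissibilityDensity hχ hg, fun f => ?_⟩, hframe, fun f => ?_⟩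
  · rw [integral_eq_lintegral_of_nonneg_ae (Filter.Eventually.of_forall fun r => by positivity)
      ((measurable_waveletTransform hHopen hfix f).norm.pow_const 2).aestronglyMeasurable]
    simp_rw [ENNReal.ofReal_pow (norm_nonneg _), ofReal_norm]
    rw [hN, ENNReal.toReal_ofReal (by positivity)]
  · have := hframe.hasSum f
    rw [inv_div] at this
    exact this
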